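/- Let $\mathfrak A$ be a complex Banach algebra (not assumed unital) whose underlying Banach space is reflexive. Suppose that $\mathfrak A$ is amenable, i.e. for every Banach $\mathfrak A$-bimodule $X$, every bounded derivation $D\colon \mathfrak A\to X^*$ (that is, bounded linear with $D(ab)=a\cdot D(b)+D(a)\cdot b$) into the dual bimodule is inner: $D(a)=a\cdot f-f\cdot a$ for some $f\in X^*$. Here the dual actions are $\langle x,a\cdot f\rangle=\langle x\cdot a,f\rangle$ and $\langle x,f\cdot a\rangle=\langle a\cdot x,f\rangle$. Suppose further that for every (closed) maximal left ideal $L$ of $\mathfrak A$: (i) the Banach space $\mathfrak A/L$ has the approximation property, i.e. its identity is a limit, uniformly on compact sets, of bounded finite rank operators; (ii) if $\pi_L\colon\mathfrak A\to\mathfrak A/L$ is the quotient map and $L^\perp=\{f\in\mathfrak A^*: f|_L=0\}$, then the bounded operator $$\pi_L\otimes\mathrm{id}_{L^\perp}\colon \mathfrak A\,\check\otimes\,L^\perp\to(\mathfrak A/L)\,\check\otimes\,L^\perp$$ between the (completed) injective tensor products is open. Then $\mathfrak A$ is trivial: there are $k\ge 0$ and $n_1,\dots,n_k\ge 1$ such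 that $\mathfrak A\cong M_{n_1}(\mathbb C)\oplus\cdots\oplus M_{n_k}(\mathbb C)$ as algebras ($k=0$ for $\mathfrak A=\{0\}$). -/

import Mathlib

set_option maxSynthPendingDepth 3

open scoped TensorProduct

noncomputable section

namespace AmenableBanach

universe u

/-! ### Reflexivity and the approximation property -/

/-- A normed space is reflexive if the canonical embedding into its bidual is onto. -/
def IsReflexive (E : Type*) [NormedAddCommGroup E] [NormedSpace ℂ E] : Prop :=
  Function.Surjective (NormedSpace.inclusionInDoubleDual ℂ E)

/-- The approximation property: the identity is a limit, uniformly on compact sets, of bounded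
finite rank operators. -/
def HasApproximationProperty (E : Type*) [NormedAddCommGroup E] [NormedSpace ℂ E] : Prop :=
  ∀ K : Set E, IsCompact K → ∀ ε : ℝ, 0 < ε →
    ∃ T : E →L[ℂ] E, FiniteDimensional ℂ (LinearMap.range (T : E →ₗ[ℂ] E)) ∧
      ∀ x ∈ K, ‖T x - x‖ < ε

/-! ### The injective tensor product -/

section Injective

variable (E F : Type*) [NormedAddCommGroup E] [NormedSpace ℂ E]
  [NormedAddCommGroup F] [NormedSpace ℂ F]

/-- The canonical map from `E ⊗ F` into the bounded bilinear forms on `E* × F*`, which sends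
`x ⊗ y` to `(φ, ψ) ↦ φ x * ψ y`. The injective norm on `E ⊗ F` is the norm induced by this
embedding, that is `‖∑ xᵢ ⊗ yᵢ‖ = sup {|∑ φ xᵢ * ψ yᵢ| : ‖φ‖ ≤ 1, ‖ψ‖ ≤ 1}`. -/
def tensorToBilin : E ⊗[ℂ] F →ₗ[ℂ] (StrongDual ℂ E →L[ℂ] StrongDual ℂ (StrongDual ℂ F)) :=
  TensorProduct.lift <| LinearMap.mk₂ ℂ
    (fun x y => (NormedSpace.inclusionInDoubleDual ℂ E x).smulRight
      (NormedSpace.inclusionInDoubleDual ℂ F y))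
    (fun x x' y => by ext φ ψ; simp [add_mul])
    (fun c x y => by ext φ ψ; simp [mul_assoc])
    (fun x y y' => by ext φ ψ; simp)
    (fun c x y => by ext φ ψ; simp [mul_left_comm])

@[simp]
theorem tensorToBilin_tmul (x : E) (y : F) (φ : StrongDual ℂ E) (ψ : StrongDual ℂ F) :
    tensorToBilin E F (x ⊗ₜ[ℂ] y) φ ψ = φ x * ψ y := by
  simp [tensorToBilin]

/-- The injective tensor product `E ⊗̌ F`: the completion of `E ⊗ F` for the injective norm,
realized as the closure of `E ⊗ F` in the Banach space of bounded bilinear forms on `E* × F*`. -/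
def InjectiveTensor : Submodule ℂ (StrongDual ℂ E →L[ℂ] StrongDual ℂ (StrongDual ℂ F)) :=
  (LinearMap.range (tensorToBilin E F)).topologicalClosure

variable {E F}
variable {E' F' : Type*} [NormedAddCommGroup E'] [NormedSpace ℂ E']
  [NormedAddCommGroup F'] [NormedSpace ℂ F']

/-- The map on bilinear forms induced by `S : E → E'` and `T : F → F'`: it sends `u` to
`(φ, ψ) ↦ u (φ ∘ S) (ψ ∘ T)`. -/
def bilinMap (S : E →L[ℂ] E') (T : F →L[ℂ] F') :
    (StrongDual ℂ E →L[ℂ] StrongDual ℂ (StrongDual ℂ F)) →L[ℂ]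
      (StrongDual ℂ E' →L[ℂ] StrongDual ℂ (StrongDual ℂ F')) :=
  (ContinuousLinearMap.postcomp (StrongDual ℂ E')
      (ContinuousLinearMap.precomp ℂ (ContinuousLinearMap.precomp ℂ T))).comp
    (ContinuousLinearMap.precomp (StrongDual ℂ (StrongDual ℂ F))
      (ContinuousLinearMap.precomp ℂ S))

@[simp]
theorem bilinMap_apply (S : E →L[ℂ] E') (T : F →L[ℂ] F')
    (u : StrongDual ℂ E →L[ℂ] StrongDual ℂ (StrongDual ℂ F))
    (φ : StrongDual ℂ E') (ψ : StrongDual ℂ F') :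
    bilinMap S T u φ ψ = u (φ.comp S) (ψ.comp T) := rfl

theorem bilinMap_tensorToBilin (S : E →L[ℂ] E') (T : F →L[ℂ] F') (t : E ⊗[ℂ] F) :
    bilinMap S T (tensorToBilin E F t) =
      tensorToBilin E' F' (TensorProduct.map (S : E →ₗ[ℂ] E') (T : F →ₗ[ℂ] F') t) := by
  induction t using TensorProduct.induction_on with
  | zero => simp
  | tmul x y => ext φ ψ; simp
  | add a b ha hb => simp only [map_add, ha, hb]

theorem bilinMap_mem (S : E →L[ℂ] E') (T : F →L[ℂ] F')
    {u : StrongDual ℂ E →L[ℂ] StrongDual ℂ (StrongDual ℂ F)} (hu : u ∈ InjectiveTensor E F) :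
    bilinMap S T u ∈ InjectiveTensor E' F' := by
  refine map_mem_closure (bilinMap S T).continuous hu ?_
  rintro _ ⟨t, rfl⟩
  exact ⟨_, (bilinMap_tensorToBilin S T t).symm⟩

/-- The bounded operator `S ⊗ T : E ⊗̌ F → E' ⊗̌ F'`, the continuous extension of the algebraic
map `x ⊗ y ↦ S x ⊗ T y`. -/
def InjectiveTensor.map (S : E →L[ℂ] E') (T : F →L[ℂ] F') :
    InjectiveTensor E F →L[ℂ] InjectiveTensor E' F' :=
  ((bilinMap S T).comp (InjectiveTensor E F).subtypeL).codRestrict (InjectiveTensor E' F')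
    (fun u => bilinMap_mem S T u.2)

end Injective

/-! ### Banach bimodules and amenability -/

/-- A Banach `A`-bimodule structure on a Banach space `X`: bounded bilinear left and right actions
`left a x = a · x` and `right a x = x · a` that are associative and commute with each other. -/
structure BanachBimodule (A X : Type*) [NonUnitalNormedRing A] [NormedSpace ℂ A]
    [NormedAddCommGroup X] [NormedSpace ℂ X] where
  left : A →L[ℂ] X →L[ℂ] X
  right : A →L[ℂ] X →L[ℂ] X
  left_mul : ∀ (a b : A) (x : X), left (a * b) x = left a (left b x)
  right_mul : ∀ (a b : A) (x : X), right (a * b) x = right b (right a x)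
  left_right : ∀ (a b : A) (x : X), left a (right b x) = right b (left a x)

namespace BanachBimodule

variable {A X : Type*} [NonUnitalNormedRing A] [NormedSpace ℂ A]
  [NormedAddCommGroup X] [NormedSpace ℂ X] (M : BanachBimodule A X)

/-- The left action on the dual: `⟨x, a · f⟩ = ⟨x · a, f⟩`. -/
def dualLeft (a : A) (f : StrongDual ℂ X) : StrongDual ℂ X := f.comp (M.right a)

/-- The right action on the dual: `⟨x, f · a⟩ = ⟨a · x, f⟩`. -/
def dualRight (a : A) (f : StrongDual ℂ X) : StrongDual ℂ X := f.comp (M.left a)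

end BanachBimodule

/-- Amenability in the sense of Johnson: for every Banach `A`-bimodule `X`, every bounded
derivation from `A` into the dual bimodule `X*` is inner. -/
def IsAmenable (A : Type u) [NonUnitalNormedRing A] [NormedSpace ℂ A] : Prop :=
  ∀ (X : Type u) [NormedAddCommGroup X] [NormedSpace ℂ X] [CompleteSpace X]
    (M : BanachBimodule A X) (D : A →L[ℂ] StrongDual ℂ X),
    (∀ a b : A, D (a * b) = M.dualLeft a (D b) + M.dualRight b (D a)) →
      ∃ f : StrongDual ℂ X, ∀ a : A, D a = M.dualLeft a f - M.dualRight a f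

/-! ### Maximal left ideals and triviality -/

/-- A linear subspace of `A` that is a left ideal. -/
def IsLeftIdeal {A : Type*} [NonUnitalNormedRing A] [NormedSpace ℂ A]
    (L : Submodule ℂ A) : Prop :=
  ∀ a : A, ∀ x ∈ L, a * x ∈ L

/-- A maximal left ideal: maximal among the proper left ideals. -/
def IsMaximalLeftIdeal {A : Type*} [NonUnitalNormedRing A] [NormedSpace ℂ A]
    (L : Submodule ℂ A) : Prop :=
  Maximal (fun J : Submodule ℂ A => IsLeftIdeal J ∧ J ≠ ⊤) L

/-- `A` is trivial: isomorphic, as an algebra, to a finite direct sum of full matrix algebras. -/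
def IsTrivial (A : Type*) [NonUnitalNormedRing A] [NormedSpace ℂ A] : Prop :=
  ∃ (k : ℕ) (n : Fin k → ℕ), (∀ i, 0 < n i) ∧
    ∃ f : A →ₙₐ[ℂ] (∀ i : Fin k, Matrix (Fin (n i)) (Fin (n i)) ℂ), Function.Bijective f

end AmenableBanach

end

noncomputable section

namespace AmenableBanach

/-! A bounded derivation from `A` into a bidual is inner by amenability, and reflexivity turns the
implementing functional into an element or an operator. With the canonical map into the bidual and
one action set to zero, this gives a right and a left unit, hence a unit `e`
(`IsAmenable.exists_unit`).

Let `L` be a closed maximal left ideal and `E = A ⧸ L`, so that `E*` is identified with `L^⊥`. A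
bounded right inverse `Q` of the quotient map must satisfy `ψ (Q e) = ψ e` for `ψ` in `L^⊥`. By
Hahn–Banach and reflexivity, such a `Q` exists once the trace of a tensor `∑ eᵢ ⊗ ψᵢ` is controlled
by its norm as a functional on bilinear forms. Openness lifts finite rank operators on `E` to `A ⊗̌
L^⊥` with norm control, so it suffices to bound the trace by the norm on finite rank operators
(`IsReflexive.norm_trace_le`). The approximation property alone gives no uniform bound on the
approximating operators. A Pietsch measure on the weakly compact unit ball replaces the operator
norm by a mean. Weakly continuous maps into a reflexive space are tight for the norm, so
approximation on one norm-compact set controls that mean.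

Amenability then corrects `Q` to a module map `ρ` (`IsAmenable.exists_module_section`), and `p = ρ
(e + L)` satisfies `L p = 0` and `p - e ∈ L`. Hence `A p ≅ A ⧸ L` is simple and not contained in
`L`; no maximal left ideal contains the socle, so `A` is semisimple. Wedderburn–Artin applies, and
the endomorphisms of simple modules are scalars by Schur and Gelfand–Mazur. -/

open Set Filter Topology

/-! ### Hahn–Banach and reflexivity of quotients. -/

section Reflexive

variable {E : Type*} [NormedAddCommGroup E] [NormedSpace ℂ E]

theorem IsReflexive.exists_eval (hE : IsReflexive E) (Θ : StrongDual ℂ (StrongDual ℂ E)) :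
    ∃ e : E, ‖e‖ = ‖Θ‖ ∧ ∀ f : StrongDual ℂ E, f e = Θ f := by
  obtain ⟨e, rfl⟩ := hE Θ
  exact ⟨e, ((NormedSpace.inclusionInDoubleDualLi ℂ (E := E)).norm_map e).symm, fun f => rfl⟩

/-- A bounded functional on a subspace of the dual of a reflexive space is an evaluation. -/
theorem IsReflexive.exists_eval_of_subspace (hE : IsReflexive E)
    (Y : Submodule ℂ (StrongDual ℂ E)) (ξ : StrongDual ℂ Y) :
    ∃ e : E, ‖e‖ = ‖ξ‖ ∧ ∀ y : Y, (y : StrongDual ℂ E) e = ξ y := by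
  obtain ⟨Θ, hΘ, hn⟩ := exists_extension_norm_eq Y ξ
  obtain ⟨e, he, h⟩ := hE.exists_eval Θ
  exact ⟨e, he.trans hn, fun y => (h y).trans (hΘ y)⟩

theorem exists_eq_zero_of_notMem {G : Submodule ℂ E} (hG : IsClosed (G : Set E)) {e : E}
    (he : e ∉ G) : ∃ f : StrongDual ℂ E, (∀ g ∈ G, f g = 0) ∧ f e ≠ 0 ∧ ‖f‖ ≤ 1 := by
  have := hG
  have h0 : G.mkQL e ≠ 0 := by
    simpa [Submodule.Quotient.mk_eq_zero] using he
  obtain ⟨g, hg, hge⟩ := exists_dual_vector ℂ (G.mkQL e) (norm_ne_zero_iff.2 h0)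
  have hf0 : g.comp G.mkQL e ≠ 0 := by
    simp only [ContinuousLinearMap.comp_apply, hge]
    simpa using h0
  have hfn : ‖g.comp G.mkQL‖ ≠ 0 := by
    intro h
    exact hf0 (by rw [norm_eq_zero.1 h]; rfl)
  refine ⟨((‖g.comp G.mkQL‖ : ℂ)⁻¹) • g.comp G.mkQL, fun x hx => ?_, ?_, ?_⟩
  · have : G.mkQL x = 0 := by simpa [Submodule.Quotient.mk_eq_zero] using hx
    simp [ContinuousLinearMap.comp_apply, this]
  · simpa using ⟨by simpa using hfn, by simpa using hf0⟩
  · rw [norm_smul]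
    simp [hfn]

/-- A functional vanishing on `L`, as a functional on the quotient by `L`. -/
def polarLift (L : Submodule ℂ E) :
    StrongDual.polarSubmodule ℂ L →L[ℂ] StrongDual ℂ (E ⧸ L) :=
  LinearMap.mkContinuous
    { toFun := fun y => L.liftQL (y : StrongDual ℂ E)
        fun x hx => (StrongDual.mem_polarSubmodule ℂ L _).1 y.2 x hx
      map_add' := fun y z => by
        ext q; obtain ⟨x, rfl⟩ := L.mkQ_surjective q; rfl
      map_smul' := fun c y => by
        ext q; obtain ⟨x, rfl⟩ := L.mkQ_surjective q; rfl } 1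
    fun y => by
      refine ContinuousLinearMap.opNorm_le_bound _ (by positivity) fun q => ?_
      refine le_of_forall_pos_lt_add fun ε hε => ?_
      obtain ⟨m, rfl, hm⟩ := Submodule.Quotient.norm_mk_lt (S := L) q
        (div_pos hε (by positivity : 0 < ‖y‖ + 1))
      calc ‖(y : StrongDual ℂ E) m‖ ≤ ‖y‖ * ‖m‖ := (y : StrongDual ℂ E).le_opNorm m
        _ ≤ ‖y‖ * (‖(Submodule.Quotient.mk m : E ⧸ L)‖ + ε / (‖y‖ + 1)) := by gcongr
        _ = 1 * ‖y‖ * ‖(Submodule.Quotient.mk m : E ⧸ L)‖ + ε * (‖y‖ / (‖y‖ + 1)) := by ring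
        _ < 1 * ‖y‖ * ‖(Submodule.Quotient.mk m : E ⧸ L)‖ + ε := by
          have : ‖y‖ / (‖y‖ + 1) < 1 := by rw [div_lt_one (by positivity)]; linarith
          nlinarith

theorem polarLift_surjective (L : Submodule ℂ E) : Function.Surjective (polarLift L) := by
  intro f
  refine ⟨⟨f.comp L.mkQL, (StrongDual.mem_polarSubmodule ℂ L _).2 fun x hx => ?_⟩, ?_⟩
  · have : L.mkQL x = 0 := (Submodule.Quotient.mk_eq_zero L).2 hx
    rw [ContinuousLinearMap.comp_apply, this, map_zero]
  · ext q
    obtain ⟨x, rfl⟩ := L.mkQ_surjective q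
    rfl

/-- The dual of the quotient is `L^⊥`; a functional on it extends to `E*`, where it is an
evaluation. -/
theorem IsReflexive.quotient (hE : IsReflexive E) (L : Submodule ℂ E) [IsClosed (L : Set E)] :
    IsReflexive (E ⧸ L) := by
  intro ξ
  obtain ⟨e, -, he⟩ := hE.exists_eval_of_subspace _ (ξ.comp (polarLift L))
  refine ⟨L.mkQL e, ?_⟩
  ext f
  obtain ⟨y, rfl⟩ := polarLift_surjective L f
  exact he y

end Reflexive

section Approximation

open MeasureTheory
open scoped ENNReal

theorem exists_measure_compl_iUnion_le {K : Type*} [MeasurableSpace K] {μ : Measure K}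
    [IsFiniteMeasure μ] {S : ℕ → Set K} (hS : ∀ n, MeasurableSet (S n))
    (h : μ (⋃ n, S n)ᶜ = 0) {ε : ℝ≥0∞} (hε : 0 < ε) :
    ∃ N, μ (⋃ n ∈ Finset.range N, S n)ᶜ ≤ ε := by
  have hm : ∀ N, MeasurableSet (⋃ n ∈ Finset.range N, S n)ᶜ := fun N =>
    (Finset.measurableSet_biUnion _ fun n _ => hS n).compl
  have ht := tendsto_measure_iInter_atTop (μ := μ)
    (s := fun N : ℕ => (⋃ n ∈ Finset.range N, S n)ᶜ) (fun N => (hm N).nullMeasurableSet)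
    (fun M N hMN => compl_subset_compl.2 (biUnion_subset_biUnion_left
      (by simpa using Finset.range_mono hMN))) ⟨0, measure_ne_top _ _⟩
  have h0 : μ (⋂ N : ℕ, (⋃ n ∈ Finset.range N, S n)ᶜ) = 0 := by
    refine measure_mono_null (fun k hk => ?_) h
    simp only [mem_iInter, mem_compl_iff, mem_iUnion, not_exists] at hk ⊢
    exact fun n hn => hk (n + 1) n (by simp) hn
  rw [h0] at ht
  obtain ⟨N, hN⟩ := (ht.eventually (gt_mem_nhds hε)).exists
  exact ⟨N, hN.le⟩

/-! ### Countable dense sets in duals of separable reflexive spaces. -/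

section

variable {E : Type*} [NormedAddCommGroup E] [NormedSpace ℂ E]

/-- If `ρ` maps onto the dual of a separable space `Y` and the functionals on the dual of `Y` are
evaluations, then `ρ` maps some countable set onto a dense set. -/
theorem exists_dense_image_dual {Y : Type*} [NormedAddCommGroup Y] [NormedSpace ℂ Y]
    [TopologicalSpace.SeparableSpace Y] (ρ : E →L[ℂ] StrongDual ℂ Y)
    (hρ : Function.Surjective ρ) (hY : IsReflexive Y) :
    ∃ d : ℕ → E, ∀ e : E, ∀ η : ℝ, 0 < η → ∃ n, ‖ρ (e - d n)‖ ≤ η := by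
  let y : ℕ → Y := TopologicalSpace.denseSeq Y
  have hd : ∀ n, ∃ d : E, ‖ρ d‖ ≤ 1 ∧ ‖y n‖ ≤ ‖ρ d (y n)‖ := by
    intro n
    obtain ⟨g, hg, hgy⟩ := exists_dual_vector'' ℂ (y n)
    obtain ⟨d, rfl⟩ := hρ g
    exact ⟨d, hg, by simp [hgy]⟩
  choose d hd1 hd2 using hd
  let S : Submodule ℂ E := Submodule.span ℂ (range d)
  have hS : TopologicalSpace.IsSeparable (S : Set E) :=
    (countable_range d).isSeparable.span
  have hdense : ∀ e, ρ e ∈ (S.map (ρ : E →ₗ[ℂ] StrongDual ℂ Y)).topologicalClosure := by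
    intro e
    by_contra hcon
    obtain ⟨ξ, hξ0, hξe, -⟩ := exists_eq_zero_of_notMem
      (Submodule.isClosed_topologicalClosure _) hcon
    obtain ⟨z, -, hz⟩ := hY.exists_eval ξ
    have hfd : ∀ n, ρ (d n) z = 0 := fun n => by
      rw [hz]
      exact hξ0 _ (Submodule.le_topologicalClosure _
        ⟨d n, Submodule.subset_span ⟨n, rfl⟩, rfl⟩)
    -- `d n` norms `y n` and kills `z`, so `z` stays away from the dense sequence unless it is zero.
    have hf : ∀ n, ‖z‖ ≤ 2 * ‖y n - z‖ := by
      intro n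
      have h1 : ‖y n‖ ≤ ‖y n - z‖ := by
        refine (hd2 n).trans ?_
        have : ρ (d n) (y n) = ρ (d n) (y n - z) := by rw [map_sub, hfd, sub_zero]
        rw [this]
        exact ((ρ (d n)).le_opNorm _).trans (mul_le_of_le_one_left (norm_nonneg _) (hd1 n))
      have h2 : ‖z‖ ≤ ‖y n‖ + ‖y n - z‖ := by
        simpa using norm_sub_le (y n) (y n - z)
      linarith
    have hz0 : z = 0 := by
      rw [← norm_le_zero_iff]
      refine le_of_forall_pos_le_add fun ε hε => ?_
      obtain ⟨n, hn⟩ := (TopologicalSpace.denseRange_denseSeq Y).exists_dist_lt z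
        (by positivity : 0 < ε / 2)
      rw [dist_comm, dist_eq_norm] at hn
      have := hf n
      change ‖y n - z‖ < ε / 2 at hn
      linarith
    exact hξe (by rw [← hz, hz0, map_zero])
  obtain ⟨c, hc, hSc⟩ := hS
  have hcn : c.Nonempty := by
    rw [nonempty_iff_ne_empty]
    rintro rfl
    simpa using hSc S.zero_mem
  obtain ⟨d', rfl⟩ := hc.exists_eq_range hcn
  refine ⟨d', fun e η hη => ?_⟩
  have h1 : ρ e ∈ closure (ρ '' range d') := by
    have : (S.map (ρ : E →ₗ[ℂ] StrongDual ℂ Y) : Set (StrongDual ℂ Y)) ⊆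
        closure (ρ '' range d') := by
      rintro _ ⟨s, hs, rfl⟩
      exact image_closure_subset_closure_image ρ.continuous ⟨s, hSc hs, rfl⟩
    exact closure_minimal this isClosed_closure (hdense e)
  obtain ⟨_, ⟨_, ⟨n, rfl⟩, rfl⟩, hn⟩ := Metric.mem_closure_iff.1 h1 η hη
  exact ⟨n, by rw [map_sub, ← dist_eq_norm]; exact hn.le⟩

/-- The evaluations at points of `E`, restricted to a subspace of the dual. -/
def evalOn (Y : Submodule ℂ (StrongDual ℂ E)) : E →L[ℂ] StrongDual ℂ Y :=
  (ContinuousLinearMap.precomp ℂ Y.subtypeL).comp (NormedSpace.inclusionInDoubleDual ℂ E)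

@[simp]
theorem evalOn_apply (Y : Submodule ℂ (StrongDual ℂ E)) (e : E) (y : Y) :
    evalOn Y e y = (y : StrongDual ℂ E) e := rfl

theorem IsReflexive.exists_evalOn_eq (hE : IsReflexive E) (Y : Submodule ℂ (StrongDual ℂ E))
    (z : StrongDual ℂ Y) : ∃ e, ‖e‖ = ‖z‖ ∧ evalOn Y e = z := by
  obtain ⟨e, hn, he⟩ := hE.exists_eval_of_subspace Y z
  exact ⟨e, hn, by ext y; exact he y⟩

/-- A closed subspace of the dual of a reflexive space is reflexive. -/
theorem IsReflexive.subspace_dual (hE : IsReflexive E) (Y : Submodule ℂ (StrongDual ℂ E))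
    (hY : IsClosed (Y : Set (StrongDual ℂ E))) : IsReflexive Y := by
  intro ξ
  -- Every functional on `Y` is evaluation at a point of `E`, so `ξ` amounts to a functional on `E`;
  -- a point of `E` separating it from `Y` would act as zero on `Y`.
  have hfY : ξ.comp (evalOn Y) ∈ Y := by
    by_contra hfY
    obtain ⟨Θ, hΘ, hΘf, -⟩ := exists_eq_zero_of_notMem hY hfY
    obtain ⟨x, -, hx⟩ := hE.exists_eval Θ
    have h0 : evalOn Y x = 0 := by
      ext z
      rw [evalOn_apply, hx, hΘ _ z.2, zero_apply]
    rw [← hx, ContinuousLinearMap.comp_apply, h0, map_zero] at hΘf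
    exact hΘf rfl
  refine ⟨⟨_, hfY⟩, ?_⟩
  ext z
  obtain ⟨e, -, rfl⟩ := hE.exists_evalOn_eq Y z
  rfl

/-- The restrictions to a separable closed subspace `Y` of the dual of a reflexive space `E` of
the elements of `E` have a countable dense subset. -/
theorem IsReflexive.exists_dense_restrict (hE : IsReflexive E) (Y : Submodule ℂ (StrongDual ℂ E))
    (hY : IsClosed (Y : Set (StrongDual ℂ E)))
    (hYs : TopologicalSpace.IsSeparable (Y : Set (StrongDual ℂ E))) :
    ∃ d : ℕ → E, ∀ e : E, ∀ η : ℝ, 0 < η → ∃ n, ∀ y ∈ Y, ‖y (e - d n)‖ ≤ η * ‖y‖ := by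
  have : TopologicalSpace.SeparableSpace Y := hYs.separableSpace
  obtain ⟨d, hd⟩ := exists_dense_image_dual (evalOn Y)
    (fun z => (hE.exists_evalOn_eq Y z).imp fun _ h => h.2) (hE.subspace_dual Y hY)
  refine ⟨d, fun e η hη => ?_⟩
  obtain ⟨n, hn⟩ := hd e η hη
  exact ⟨n, fun y hy => (evalOn Y (e - d n)).le_of_opNorm_le hn ⟨y, hy⟩⟩

end

/-! ### Weakly continuous maps into reflexive spaces: separable range and tightness. -/

section WeaklyContinuous

theorem isClosed_setOf_norm_dual_le {E : Type*} [NormedAddCommGroup E] [NormedSpace ℂ E]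
    {K : Type*} [TopologicalSpace K] {x : K → E}
    (hx : ∀ f : StrongDual ℂ E, Continuous fun k => f (x k))
    (Y : Set (StrongDual ℂ E)) (d : E) (η : ℝ) :
    IsClosed {k | ∀ y ∈ Y, ‖y (x k - d)‖ ≤ η * ‖y‖} := by
  simp only [ofPred_forall]
  refine isClosed_iInter fun y => isClosed_iInter fun _ => ?_
  simp only [map_sub]
  exact isClosed_le ((hx y).sub continuous_const).norm continuous_const

variable {E : Type*} [NormedAddCommGroup E] [NormedSpace ℂ E]
  {K : Type*} [TopologicalSpace K] [CompactSpace K] [MeasurableSpace K] [BorelSpace K]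
  {μ : Measure K} [IsFiniteMeasure μ] {x : K → E}

theorem integrable_norm_dual (hx : ∀ f : StrongDual ℂ E, Continuous fun k => f (x k))
    (f : StrongDual ℂ E) : Integrable (fun k => ‖f (x k)‖) μ :=
  (hx f).norm.integrable_of_hasCompactSupport (HasCompactSupport.of_compactSpace _)

/-- The map into `L¹` induced by a weakly continuous function with values in a reflexive space
is compact, here in the form that it maps no bounded sequence to a separated one. -/
theorem IsReflexive.exists_integral_norm_sub_lt (hE : IsReflexive E)
    (hx : ∀ f : StrongDual ℂ E, Continuous fun k => f (x k)) (hx1 : ∀ k, ‖x k‖ ≤ 1)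
    (f : ℕ → StrongDual ℂ E) (hf : ∀ n, ‖f n‖ ≤ 1) {ε : ℝ} (hε : 0 < ε) :
    ∃ m n, m < n ∧ ∫ k, ‖(f m - f n) (x k)‖ ∂μ < ε := by
  let Y : Submodule ℂ (StrongDual ℂ E) := (Submodule.span ℂ (range f)).topologicalClosure
  have hfY : ∀ n, f n ∈ Y := fun n =>
    Submodule.le_topologicalClosure _ (Submodule.subset_span ⟨n, rfl⟩)
  obtain ⟨d, hd⟩ := hE.exists_dense_restrict Y (Submodule.isClosed_topologicalClosure _)
    (countable_range f).isSeparable.span.closure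
  set M : ℝ := μ.real univ with hM
  have hM0 : 0 ≤ M := measureReal_nonneg
  -- The integrand is at most `3 * η` off a bad set of measure at most `η`, and at most 2 on it: in
  -- total `3 * M * η + 2 * η < ε`.
  set η : ℝ := ε / (3 * M + 3) with hη
  have hη0 : 0 < η := by positivity
  let S : ℕ → Set K := fun n => {k | ∀ y ∈ (Y : Set (StrongDual ℂ E)), ‖y (x k - d n)‖ ≤ η * ‖y‖}
  have hS : ∀ n, MeasurableSet (S n) := fun n =>
    (isClosed_setOf_norm_dual_le hx _ _ _).measurableSet
  have hcov : μ (⋃ n, S n)ᶜ = 0 := by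
    have : (⋃ n, S n) = univ := eq_univ_of_forall fun k => by
      obtain ⟨n, hn⟩ := hd (x k) η hη0
      exact mem_iUnion.2 ⟨n, hn⟩
    simp [this]
  obtain ⟨N, hN⟩ := exists_measure_compl_iUnion_le hS hcov (ENNReal.ofReal_pos.2 hη0)
  set bad : Set K := (⋃ n ∈ Finset.range N, S n)ᶜ with hbad
  have hbadm : MeasurableSet bad := (Finset.measurableSet_biUnion _ fun n _ => hS n).compl
  have hbadr : μ.real bad ≤ η := ENNReal.toReal_le_of_le_ofReal hη0.le hN
  -- two members of the sequence nearly agree at the chosen points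
  obtain ⟨m, n, hmn, hclose⟩ : ∃ m n, m < n ∧ ∀ j ∈ Finset.range N, ‖(f m - f n) (d j)‖ ≤ η := by
    let v : ℕ → (Fin N → ℂ) := fun n j => f n (d j)
    have hv : ∀ n, v n ∈ Metric.closedBall (0 : Fin N → ℂ) (∑ j : Fin N, ‖d j‖) := by
      intro n
      rw [mem_closedBall_zero_iff, pi_norm_le_iff_of_nonneg (by positivity)]
      intro j
      calc ‖f n (d j)‖ ≤ ‖f n‖ * ‖d j‖ := (f n).le_opNorm _
        _ ≤ 1 * ‖d j‖ := by gcongr; exact hf n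
        _ ≤ ∑ j : Fin N, ‖d j‖ := by
          rw [one_mul]
          exact Finset.single_le_sum (f := fun j : Fin N => ‖d j‖) (fun _ _ => norm_nonneg _)
            (Finset.mem_univ j)
    obtain ⟨a, -, φ, hφ, hlim⟩ := tendsto_subseq_of_bounded Metric.isBounded_closedBall hv
    obtain ⟨p, hp⟩ := Metric.cauchySeq_iff.1 hlim.cauchySeq η hη0
    refine ⟨φ p, φ (p + 1), hφ (Nat.lt_succ_self p), fun j hj => ?_⟩
    have := hp p le_rfl (p + 1) (Nat.le_succ p)
    rw [dist_eq_norm] at this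
    exact (norm_le_pi_norm (v (φ p) - v (φ (p + 1))) ⟨j, Finset.mem_range.1 hj⟩).trans this.le
  refine ⟨m, n, hmn, ?_⟩
  have hfmn : ‖f m - f n‖ ≤ 2 := (norm_sub_le _ _).trans (by linarith [hf m, hf n])
  have hpt : ∀ k, ‖(f m - f n) (x k)‖ ≤ 3 * η + bad.indicator (fun _ => 2) k := by
    intro k
    by_cases hk : k ∈ bad
    · rw [indicator_of_mem hk]
      have := (f m - f n).le_opNorm (x k)
      nlinarith [hx1 k, norm_nonneg (x k), norm_nonneg (f m - f n)]
    · rw [indicator_of_notMem hk, add_zero]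
      simp only [hbad, mem_compl_iff, not_not, mem_iUnion, exists_prop] at hk
      obtain ⟨j, hj, hkj⟩ := hk
      have h1 := hkj (f m - f n) (Y.sub_mem (hfY m) (hfY n))
      have h2 := hclose j hj
      have h3 : (f m - f n) (x k) = (f m - f n) (x k - d j) + (f m - f n) (d j) := by
        rw [← map_add, sub_add_cancel]
      rw [h3]
      refine (norm_add_le _ _).trans ?_
      nlinarith
  calc ∫ k, ‖(f m - f n) (x k)‖ ∂μ
      ≤ ∫ k, (3 * η + bad.indicator (fun _ => (2 : ℝ)) k) ∂μ := by
        refine integral_mono (integrable_norm_dual hx _) ?_ hpt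
        exact (integrable_const _).add ((integrable_const _).indicator hbadm)
    _ = M * (3 * η) + μ.real bad * 2 := by
        rw [integral_add (integrable_const _) ((integrable_const _).indicator hbadm),
          integral_indicator_const _ hbadm, integral_const]
        simp [hM]
    _ ≤ M * (3 * η) + η * 2 := by gcongr
    _ < ε := by
        have : η * (3 * M + 3) = ε := by rw [hη]; field_simp
        nlinarith

/-- Without finite nets, a greedy choice would give a separated sequence, against the compactness
just proved; so the unit ball of the dual is totally bounded in `L¹`. -/
theorem IsReflexive.exists_countable_dense_dual (hE : IsReflexive E)
    (hx : ∀ f : StrongDual ℂ E, Continuous fun k => f (x k)) (hx1 : ∀ k, ‖x k‖ ≤ 1) :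
    ∃ g : ℕ → StrongDual ℂ E, ∀ f : StrongDual ℂ E, ‖f‖ ≤ 1 → ∀ ε : ℝ, 0 < ε →
      ∃ n, ∫ k, ‖(f - g n) (x k)‖ ∂μ < ε := by
  have hfin : ∀ ε : ℝ, 0 < ε → ∃ s : Finset (StrongDual ℂ E), ∀ f : StrongDual ℂ E, ‖f‖ ≤ 1 →
      ∃ g ∈ s, ∫ k, ‖(f - g) (x k)‖ ∂μ < ε := by
    intro ε hε
    by_contra! hcon
    obtain ⟨f, hf1, hf2⟩ := exists_seq_of_forall_finset_exists
      (fun f : StrongDual ℂ E => ‖f‖ ≤ 1) (fun g f => ε ≤ ∫ k, ‖(f - g) (x k)‖ ∂μ)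
      (fun s _ => hcon s)
    obtain ⟨m, n, hmn, hlt⟩ := hE.exists_integral_norm_sub_lt (μ := μ) hx hx1 f hf1 hε
    have := hf2 m n hmn
    rw [← neg_sub] at hlt
    simp only [neg_apply, norm_neg] at hlt
    linarith
  choose! s hs using hfin
  let c : Set (StrongDual ℂ E) := ⋃ m : ℕ, (s (1 / ((m : ℝ) + 1)) : Set (StrongDual ℂ E))
  have hc : c.Countable := countable_iUnion fun m => (s _).countable_toSet
  have hcn : c.Nonempty := by
    obtain ⟨g, hg, -⟩ := hs (1 / ((0 : ℕ) + 1)) (by positivity) 0 (by simp)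
    exact ⟨g, mem_iUnion.2 ⟨0, hg⟩⟩
  obtain ⟨g, hg⟩ := hc.exists_eq_range hcn
  refine ⟨g, fun f hf ε hε => ?_⟩
  obtain ⟨m, hm⟩ := exists_nat_one_div_lt hε
  obtain ⟨h, hh, hlt⟩ := hs (1 / ((m : ℝ) + 1)) (by positivity) f hf
  obtain ⟨n, rfl⟩ : h ∈ range g := hg ▸ mem_iUnion.2 ⟨m, hh⟩
  exact ⟨n, hlt.trans hm⟩

/-- A weakly continuous function into a reflexive space has essentially separable range. -/
theorem IsReflexive.exists_separable_ae_mem (hE : IsReflexive E) [T2Space K] [μ.Regular]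
    (hx : ∀ f : StrongDual ℂ E, Continuous fun k => f (x k)) (hx1 : ∀ k, ‖x k‖ ≤ 1) :
    ∃ G : Set E, TopologicalSpace.IsSeparable G ∧ μ {k | x k ∉ G} = 0 := by
  obtain ⟨g, hg⟩ := hE.exists_countable_dense_dual (μ := μ) hx hx1
  have hint : ∀ f h : StrongDual ℂ E, Integrable (fun k => f (x k) * star (h (x k))) μ :=
    fun f h => ((hx f).mul (hx h).star).integrable_of_hasCompactSupport
      (HasCompactSupport.of_compactSpace _)
  have hbd : ∀ f : StrongDual ℂ E, ∀ k, ‖f (x k)‖ ≤ ‖f‖ := fun f k =>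
    (f.le_opNorm _).trans (mul_le_of_le_one_right (norm_nonneg _) (hx1 k))
  -- The weak integral of `x` against the conjugate of `h ∘ x` lies in `E` by reflexivity. The weak
  -- integrals for the `g n` will span the essential range.
  have hrep : ∀ h : StrongDual ℂ E, ∃ e : E, ∀ f : StrongDual ℂ E,
      f e = ∫ k, f (x k) * star (h (x k)) ∂μ := by
    intro h
    let Θ : StrongDual ℂ (StrongDual ℂ E) := LinearMap.mkContinuous
      { toFun := fun f => ∫ k, f (x k) * star (h (x k)) ∂μ
        map_add' := fun f f' => by
          rw [← integral_add (hint f h) (hint f' h)]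
          simp [add_mul]
        map_smul' := fun c f => by
          rw [RingHom.id_apply, smul_eq_mul, ← integral_const_mul]
          simp [mul_assoc] } (‖h‖ * μ.real univ) (fun f => by
        calc ‖∫ k, f (x k) * star (h (x k)) ∂μ‖ ≤ ‖f‖ * ‖h‖ * μ.real univ := by
              refine norm_integral_le_of_norm_le_const (Eventually.of_forall fun k => ?_)
              rw [norm_mul, norm_star]
              gcongr <;> exact hbd _ _
          _ = ‖h‖ * μ.real univ * ‖f‖ := by ring)
    obtain ⟨e, -, he⟩ := hE.exists_eval Θ
    exact ⟨e, he⟩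
  choose r hr using hrep
  let G : Submodule ℂ E := (Submodule.span ℂ (range fun n => r (g n))).topologicalClosure
  have hGc : IsClosed (G : Set E) := Submodule.isClosed_topologicalClosure _
  refine ⟨G, (countable_range _).isSeparable.span.closure, ?_⟩
  have hzero : ∀ f : StrongDual ℂ E, ‖f‖ ≤ 1 → (∀ e ∈ G, f e = 0) → μ {k | f (x k) ≠ 0} = 0 := by
    intro f hf1 hf
    -- If `f` kills `G`, then `f ∘ x` is orthogonal to each `g n ∘ x` in `L²`, while some `g n ∘ x`
    -- is `L¹`-close to `f ∘ x`, and `f ∘ x` is bounded by 1.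
    have hsq : ∫ k, ‖f (x k)‖ ^ 2 ∂μ ≤ 0 := by
      refine le_of_forall_pos_le_add fun ε hε => ?_
      obtain ⟨n, hn⟩ := hg f hf1 ε hε
      have h0 : ∫ k, f (x k) * star (g n (x k)) ∂μ = 0 := by
        rw [← hr]
        exact hf _ (Submodule.le_topologicalClosure _ (Submodule.subset_span ⟨n, rfl⟩))
      have h1 : ∫ k, f (x k) * star ((f - g n) (x k)) ∂μ = ∫ k, f (x k) * star (f (x k)) ∂μ := by
        rw [← sub_zero (∫ k, f (x k) * star (f (x k)) ∂μ), ← h0,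
          ← integral_sub (hint f f) (hint f (g n))]
        simp [mul_sub]
      have h2 : ∫ k, f (x k) * star (f (x k)) ∂μ = ((∫ k, ‖f (x k)‖ ^ 2 ∂μ : ℝ) : ℂ) := by
        rw [← integral_complex_ofReal]
        congr 1 with k
        rw [RCLike.star_def, RCLike.mul_conj]
        push_cast; rfl
      have h3 : ‖∫ k, f (x k) * star ((f - g n) (x k)) ∂μ‖ ≤ ∫ k, ‖(f - g n) (x k)‖ ∂μ := by
        refine (norm_integral_le_integral_norm _).trans ?_
        refine integral_mono (hint _ _).norm (integrable_norm_dual hx _) fun k => ?_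
        simp only [norm_mul, norm_star]
        exact mul_le_of_le_one_left (norm_nonneg _) ((hbd f k).trans hf1)
      rw [h1, h2, Complex.norm_real] at h3
      linarith [Real.le_norm_self (∫ k, ‖f (x k)‖ ^ 2 ∂μ)]
    have hi : Integrable (fun k => ‖f (x k)‖ ^ 2) μ :=
      ((hx f).norm.pow 2).integrable_of_hasCompactSupport (HasCompactSupport.of_compactSpace _)
    have h0 : ∫ k, ‖f (x k)‖ ^ 2 ∂μ = 0 := le_antisymm hsq (integral_nonneg fun k => by positivity)
    rw [integral_eq_zero_iff_of_nonneg (fun k => by positivity) hi] at h0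
    have : ∀ᵐ k ∂μ, f (x k) = 0 := by
      filter_upwards [h0] with k hk
      simpa using hk
    exact this
  have hopen : ∀ f : StrongDual ℂ E, IsOpen {k | f (x k) ≠ 0} := fun f =>
    isOpen_ne_fun (hx f) continuous_const
  have hU : {k | x k ∉ (G : Set E)} =
      ⋃ f : {f : StrongDual ℂ E // ‖f‖ ≤ 1 ∧ ∀ e ∈ G, f e = 0}, {k | f.1 (x k) ≠ 0} := by
    refine Set.ext fun k => ⟨fun hk => ?_, fun h hk => ?_⟩
    · obtain ⟨f, hf0, hfk, hf1⟩ := exists_eq_zero_of_notMem hGc hk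
      exact mem_iUnion.2 ⟨⟨f, hf1, hf0⟩, hfk⟩
    · obtain ⟨f, hfk⟩ := mem_iUnion.1 h
      exact hfk (f.2.2 _ hk)
  have hUo : IsOpen {k | x k ∉ (G : Set E)} := by
    rw [hU]
    exact isOpen_iUnion fun f => hopen f.1
  -- The union of open null sets may be uncountable; inner regularity reduces to compact sets, which
  -- finitely many of them cover.
  rw [hUo.measure_eq_iSup_isCompact, hU]
  simp only [ENNReal.iSup_eq_zero]
  intro C hC hCc
  refine hCc.measure_zero_of_nhdsWithin fun k hk => ?_
  obtain ⟨f, hf⟩ := mem_iUnion.1 (hC hk)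
  exact ⟨_, mem_nhdsWithin_of_mem_nhds ((hopen f.1).mem_nhds hf), hzero f.1 f.2.1 f.2.2⟩

/-- A weakly continuous function into a reflexive space is tight. -/
theorem IsReflexive.exists_isCompact_measure_le (hE : IsReflexive E) [CompleteSpace E] [T2Space K]
    [μ.Regular] (hx : ∀ f : StrongDual ℂ E, Continuous fun k => f (x k)) (hx1 : ∀ k, ‖x k‖ ≤ 1)
    {ε : ℝ≥0∞} (hε : 0 < ε) :
    ∃ C : Set E, IsCompact C ∧ MeasurableSet {k | x k ∈ C} ∧ μ {k | x k ∉ C} ≤ ε := by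
  obtain ⟨G, ⟨c, hc, hGc⟩, hGμ⟩ := hE.exists_separable_ae_mem (μ := μ) hx hx1
  rcases c.eq_empty_or_nonempty with rfl | hcn
  · refine ⟨∅, isCompact_empty, by simp, ?_⟩
    have : {k | x k ∉ (∅ : Set E)} ⊆ {k | x k ∉ G} := fun k _ hk => by simpa using hGc hk
    exact (measure_mono this).trans (hGμ.le.trans hε.le)
  obtain ⟨d, rfl⟩ := hc.exists_eq_range hcn
  have hball : ∀ (e : E) (r : ℝ), 0 ≤ r → IsClosed {k | x k ∈ Metric.closedBall e r} := by
    intro e r hr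
    have : {k | x k ∈ Metric.closedBall e r} =
        {k | ∀ y ∈ (univ : Set (StrongDual ℂ E)), ‖y (x k - e)‖ ≤ r * ‖y‖} := by
      ext k
      simp only [mem_ofPred_eq, Metric.mem_closedBall, dist_eq_norm, mem_univ, true_implies]
      constructor
      · intro h y
        rw [mul_comm]
        exact (y.le_opNorm _).trans (by gcongr)
      · intro h
        obtain ⟨y, hy, hye⟩ := exists_dual_vector'' ℂ (x k - e)
        have := h y
        rw [hye] at this
        simp only [RCLike.norm_ofReal, abs_norm] at this
        exact this.trans (mul_le_of_le_one_right hr hy)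
    rw [this]
    exact isClosed_setOf_norm_dual_le hx _ _ _
  obtain ⟨δ, hδ0, hδ⟩ := ENNReal.exists_pos_sum_of_countable' hε.ne' ℕ
  have hcov : ∀ m : ℕ, μ (⋃ n, {k | x k ∈ Metric.closedBall (d n) (1 / ((m : ℝ) + 1))})ᶜ = 0 := by
    intro m
    refine measure_mono_null (t := {k | x k ∉ G}) (fun k hk hkG => hk ?_) hGμ
    obtain ⟨_, ⟨n, rfl⟩, hn⟩ := Metric.mem_closure_iff.1 (hGc hkG) (1 / ((m : ℝ) + 1))
      (by positivity)
    exact mem_iUnion.2 ⟨n, Metric.mem_closedBall.2 hn.le⟩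
  choose N hN using fun m : ℕ => exists_measure_compl_iUnion_le
    (fun n => (hball (d n) (1 / ((m : ℝ) + 1)) (by positivity)).measurableSet) (hcov m) (hδ0 m)
  -- Ulam's construction: at each scale, finitely many balls miss measure at most `δ m`, and these
  -- errors sum to less than `ε`.
  let C : Set E := ⋂ m : ℕ, ⋃ n ∈ Finset.range (N m), Metric.closedBall (d n) (1 / ((m : ℝ) + 1))
  have hCclosed : IsClosed C := isClosed_iInter fun m =>
    (Finset.range (N m)).finite_toSet.isClosed_biUnion fun n _ => Metric.isClosed_closedBall
  have hCtb : TotallyBounded C := by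
    rw [Metric.totallyBounded_iff]
    intro ε hε
    obtain ⟨m, hm⟩ := exists_nat_one_div_lt hε
    refine ⟨d '' (Finset.range (N m)), ((Finset.range (N m)).finite_toSet.image d), fun e he => ?_⟩
    have := mem_iInter.1 he m
    simp only [mem_iUnion, exists_prop] at this
    obtain ⟨n, hn, hen⟩ := this
    simp only [mem_iUnion, exists_prop]
    exact ⟨d n, ⟨n, hn, rfl⟩, Metric.closedBall_subset_ball hm hen⟩
  have hpre : {k | x k ∈ C} = ⋂ m : ℕ, ⋃ n ∈ Finset.range (N m),
      {k | x k ∈ Metric.closedBall (d n) (1 / ((m : ℝ) + 1))} := by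
    ext k; simp [C]
  refine ⟨C, TotallyBounded.isCompact_of_isClosed hCtb hCclosed, ?_, ?_⟩
  · rw [hpre]
    exact MeasurableSet.iInter fun m => Finset.measurableSet_biUnion _ fun n _ =>
      (hball _ _ (by positivity)).measurableSet
  · have : {k | x k ∉ C} = ⋃ m : ℕ, (⋃ n ∈ Finset.range (N m),
        {k | x k ∈ Metric.closedBall (d n) (1 / ((m : ℝ) + 1))})ᶜ := by
      rw [← compl_iInter, ← hpre]; rfl
    rw [this]
    exact (measure_iUnion_le _).trans ((ENNReal.tsum_le_tsum hN).trans hδ.le)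

end WeaklyContinuous

/-! ### Pietsch domination by Hahn–Banach and Riesz. -/

section Domination

open CompactlySupported

/-- A Pietsch type domination: a functional bounded by the supremum of a family of sublinear
continuous functions is bounded by their integral for a suitable measure of mass at most one. -/
theorem exists_measure_dominating {K : Type*} [TopologicalSpace K] [CompactSpace K] [T2Space K]
    [Nonempty K] [MeasurableSpace K] [BorelSpace K] {V : Type*} [AddCommGroup V] [Module ℝ V]
    (U : V →ₗ[ℝ] ℝ) (q : V → C(K, ℝ)) (hadd : ∀ v w k, q (v + w) k ≤ q v k + q w k)
    (hsmul : ∀ c : ℝ, 0 < c → ∀ v k, q (c • v) k = c * q v k)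
    (hU : ∀ v c, (∀ k, q v k ≤ c) → U v ≤ c) :
    ∃ μ : Measure K, IsFiniteMeasure μ ∧ μ.Regular ∧ μ univ ≤ 1 ∧
      ∀ v, U v ≤ ∫ k, q v k ∂μ := by
  have hq0 : ∀ k, q 0 k = 0 := fun k => by
    have := hsmul 2 two_pos 0 k
    rw [smul_zero] at this
    linarith
  let S : C(K, ℝ) → Set ℝ := fun g => {c | ∃ v, ∀ k, g k + q v k ≤ c + U v}
  have hSbdd : ∀ g, ∀ c ∈ S g, -‖g‖ ≤ c := by
    rintro g c ⟨v, hv⟩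
    have := hU v (c + U v + ‖g‖) fun k => by
      have h1 := hv k
      have h2 := (abs_le.1 (g.norm_coe_le_norm k)).1
      linarith
    linarith
  have hSne : ∀ g, ‖g‖ ∈ S g := fun g => ⟨0, fun k => by
    rw [hq0, map_zero, add_zero, add_zero]
    exact (abs_le.1 (g.norm_coe_le_norm k)).2⟩
  have hSB : ∀ g, BddBelow (S g) := fun g => ⟨_, hSbdd g⟩
  -- `N` is sublinear and encodes all demands on a dominated functional: `N (-g) ≤ 0` for `g ≥ 0`
  -- gives positivity, `N 1 ≤ 1` the mass, and `N (-q v) ≤ -U v` the domination.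
  let N : C(K, ℝ) → ℝ := fun g => sInf (S g)
  have hN0 : 0 ≤ N 0 := le_csInf ⟨_, hSne 0⟩ fun c hc => by simpa using hSbdd 0 c hc
  have hNle : ∀ g c, c ∈ S g → N g ≤ c := fun g c hc => csInf_le (hSB g) hc
  have hNsmul_le : ∀ c : ℝ, 0 < c → ∀ g, N (c • g) ≤ c * N g := by
    intro c hc g
    rw [← div_le_iff₀' hc]
    refine le_csInf ⟨_, hSne g⟩ fun a ha => ?_
    rw [div_le_iff₀' hc]
    obtain ⟨v, hv⟩ := ha
    refine hNle _ _ ⟨c • v, fun k => ?_⟩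
    rw [hsmul c hc, map_smul, ContinuousMap.smul_apply, smul_eq_mul, smul_eq_mul, ← mul_add,
      ← mul_add]
    exact mul_le_mul_of_nonneg_left (hv k) hc.le
  obtain ⟨Λ, -, hΛ⟩ := exists_extension_of_le_sublinear (⊥ : C(K, ℝ) →ₗ.[ℝ] ℝ) N
    (fun c hc g => le_antisymm (hNsmul_le c hc g) (by
      have := hNsmul_le c⁻¹ (inv_pos.2 hc) (c • g)
      rw [smul_smul, inv_mul_cancel₀ hc.ne', one_smul] at this
      rwa [← div_eq_inv_mul, le_div_iff₀' hc] at this))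
    (fun g h => by
      rw [← sub_le_iff_le_add]
      refine le_csInf ⟨_, hSne g⟩ fun a ha => ?_
      rw [sub_le_comm]
      refine le_csInf ⟨_, hSne h⟩ fun b hb => ?_
      rw [sub_le_iff_le_add, add_comm b a]
      obtain ⟨v, hv⟩ := ha
      obtain ⟨w, hw⟩ := hb
      refine hNle _ _ ⟨v + w, fun k => ?_⟩
      have := hadd v w k
      rw [map_add, ContinuousMap.add_apply]
      linarith [hv k, hw k])
    (fun g => by
      have hg : (g : C(K, ℝ)) = 0 := (Submodule.mem_bot ℝ).1 g.2
      have : (⊥ : C(K, ℝ) →ₗ.[ℝ] ℝ) g = 0 := by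
        have : g = 0 := Subtype.ext hg
        rw [this, LinearPMap.map_zero]
      rw [this, hg]
      exact hN0)
  have hpos : ∀ g : C(K, ℝ), (∀ k, 0 ≤ g k) → 0 ≤ Λ g := by
    intro g hg
    have h1 : Λ (-g) ≤ 0 := (hΛ _).trans (hNle _ _ ⟨0, fun k => by simpa [hq0] using hg k⟩)
    rw [map_neg] at h1
    linarith
  let Λc : C_c(K, ℝ) →ₚ[ℝ] ℝ := PositiveLinearMap.mk₀
    { toFun := fun f => Λ f.toContinuousMap
      map_add' := fun f g => by rw [← map_add]; rfl
      map_smul' := fun c f => by rw [RingHom.id_apply, ← map_smul]; rfl }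
    (fun f hf => hpos _ hf)
  let μ := RealRMK.rieszMeasure Λc
  have hreg : μ.Regular := inferInstance
  have hfin : IsFiniteMeasure μ := inferInstance
  have hint : ∀ g : C(K, ℝ), ∫ k, g k ∂μ = Λ g := fun g =>
    RealRMK.integral_rieszMeasure Λc ⟨g, HasCompactSupport.of_compactSpace _⟩
  refine ⟨μ, hfin, hreg, ?_, fun v => ?_⟩
  · have h1 : μ.real univ ≤ 1 := by
      have h2 := hint 1
      simp only [ContinuousMap.one_apply, integral_const, smul_eq_mul, mul_one] at h2
      rw [h2]
      exact (hΛ _).trans (hNle _ _ ⟨0, fun k => by simp [hq0]⟩)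
    rw [← ENNReal.ofReal_one, ← ENNReal.ofReal_toReal (measure_ne_top μ univ)]
    exact ENNReal.ofReal_le_ofReal h1
  · rw [hint]
    have h1 : Λ (-q v) ≤ -U v := (hΛ _).trans (hNle _ _ ⟨v, fun k => by simp⟩)
    rw [map_neg] at h1
    linarith

end Domination

/-! ### Finite rank operators as tensors. -/

section FiniteRank

variable {E : Type*} [NormedAddCommGroup E] [NormedSpace ℂ E]

/-- The finite rank operator given by a tensor. -/
def tensorToOp (E : Type*) [NormedAddCommGroup E] [NormedSpace ℂ E] :
    E ⊗[ℂ] StrongDual ℂ E →ₗ[ℂ] (E →L[ℂ] E) :=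
  TensorProduct.lift <| LinearMap.mk₂ ℂ (fun a χ => χ.smulRight a)
    (fun a a' χ => by ext; simp) (fun c a χ => by ext; simp [smul_smul, mul_comm])
    (fun a χ χ' => by ext; simp [add_smul]) (fun c a χ => by ext; simp [mul_smul])

@[simp]
theorem tensorToOp_tmul (a : E) (χ : StrongDual ℂ E) (x : E) :
    tensorToOp E (a ⊗ₜ[ℂ] χ) x = χ x • a := by
  simp [tensorToOp]

theorem exists_tensorToOp_eq (T : E →L[ℂ] E)
    (hT : FiniteDimensional ℂ (LinearMap.range (T : E →ₗ[ℂ] E))) :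
    ∃ t, tensorToOp E t = T := by
  let b := Module.finBasis ℂ (LinearMap.range (T : E →ₗ[ℂ] E))
  let T' : E →L[ℂ] LinearMap.range (T : E →ₗ[ℂ] E) := T.codRestrict _ fun x => ⟨x, rfl⟩
  refine ⟨∑ i, (b i : E) ⊗ₜ[ℂ] ((LinearMap.toContinuousLinearMap (b.coord i)).comp T'), ?_⟩
  ext x
  rw [map_sum, sum_apply]
  have h := congrArg (Subtype.val) (b.sum_repr (T' x))
  rw [Submodule.coe_sum] at h
  refine Eq.trans (Finset.sum_congr rfl fun i _ => ?_) h
  rw [tensorToOp_tmul]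
  rfl

theorem continuous_tensorToOp {K : Type*} [TopologicalSpace K] {x : K → E}
    (hx : ∀ f : StrongDual ℂ E, Continuous fun k => f (x k)) (t : E ⊗[ℂ] StrongDual ℂ E) :
    Continuous fun k => tensorToOp E t (x k) := by
  induction t using TensorProduct.induction_on with
  | zero => simpa using continuous_const
  | tmul a χ =>
    simp only [tensorToOp_tmul]
    exact (hx χ).smul continuous_const
  | add s t hs ht =>
    simp only [map_add, add_apply]
    exact hs.add ht

end FiniteRank

/-! ### The approximation property in mean and the trace estimate. -/

/-- The closure of a union of compact sets that shrink to zero is compact. -/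
theorem isCompact_closure_iUnion {E : Type*} [NormedAddCommGroup E] [CompleteSpace E]
    {S : ℕ → Set E} (hS : ∀ n, IsCompact (S n)) {r : ℕ → ℝ} (hr : Tendsto r atTop (𝓝 0))
    (hSr : ∀ n, ∀ y ∈ S n, ‖y‖ ≤ r n) : IsCompact (closure (⋃ n, S n)) := by
  refine TotallyBounded.isCompact_of_isClosed (TotallyBounded.closure ?_) isClosed_closure
  rw [Metric.totallyBounded_iff]
  intro ε hε
  obtain ⟨N, hN⟩ := eventually_atTop.1 (hr.eventually (gt_mem_nhds hε))
  have hc : IsCompact (⋃ n ∈ Finset.range N, S n) :=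
    (Finset.range N).isCompact_biUnion fun n _ => hS n
  obtain ⟨t, ht, htc⟩ := Metric.totallyBounded_iff.1 hc.totallyBounded ε hε
  refine ⟨insert 0 t, ht.insert 0, fun y hy => ?_⟩
  obtain ⟨n, hn⟩ := mem_iUnion.1 hy
  rw [biUnion_insert]
  by_cases hnN : n < N
  · exact Or.inr (htc (mem_biUnion (by simpa using hnN) hn))
  · exact Or.inl (by simpa using (hSr n y hn).trans_lt (hN n (not_lt.1 hnN)))

/-- On a reflexive space with the approximation property, some finite rank operator is close to
the identity at given points and has nearly contractive mean along a given weakly continuous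
function into the unit ball. -/
theorem IsReflexive.exists_approx {E : Type*} [NormedAddCommGroup E] [NormedSpace ℂ E]
    [CompleteSpace E] (hE : IsReflexive E) (hAP : HasApproximationProperty E)
    {K : Type*} [TopologicalSpace K] [CompactSpace K] [T2Space K] [MeasurableSpace K]
    [BorelSpace K] (μ : Measure K) [IsFiniteMeasure μ] [μ.Regular] (hμ : μ univ ≤ 1) {x : K → E}
    (hx : ∀ f : StrongDual ℂ E, Continuous fun k => f (x k)) (hx1 : ∀ k, ‖x k‖ ≤ 1)
    {s : Set E} (hs : IsCompact s) {δ : ℝ} (hδ : 0 < δ) :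
    ∃ t : E ⊗[ℂ] StrongDual ℂ E, (∀ e ∈ s, ‖tensorToOp E t e - e‖ < δ) ∧
      ∫ k, ‖tensorToOp E t (x k)‖ ∂μ ≤ 1 + 2 * δ := by
  obtain ⟨w, hw0, hw⟩ := ENNReal.exists_pos_sum_of_countable' one_ne_zero ℕ
  have hex : ∀ n : ℕ, ∃ C : Set E, IsCompact C ∧ MeasurableSet {k | x k ∈ C} ∧
      μ {k | x k ∉ C} ≤ w n / 2 ^ (n + 1) := fun n =>
    hE.exists_isCompact_measure_le hx hx1 (ENNReal.div_pos (hw0 n).ne' (by simp))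
  choose C hC hCm hCμ using hex
  -- Shrinking `C n` by `2 ^ n` puts all of them in one compact set. An error `δ` there is an error
  -- `δ * 2 ^ n` on `C n`, offset by the small measure of the complements.
  let S : ℕ → Set E := fun n => (fun y => (((2 : ℂ) ^ n)⁻¹) • y) '' (C n ∩ Metric.closedBall 0 1)
  have hS : ∀ n, IsCompact (S n) := fun n =>
    ((hC n).inter_right Metric.isClosed_closedBall).image (continuous_const_smul _)
  have hcomp : IsCompact (closure (⋃ n, S n)) := by
    refine isCompact_closure_iUnion hS
      (tendsto_pow_atTop_nhds_zero_of_lt_one (r := (1 / 2 : ℝ)) (by norm_num) (by norm_num)) ?_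
    rintro n _ ⟨y, ⟨-, hy⟩, rfl⟩
    rw [mem_closedBall_zero_iff] at hy
    simp only [norm_smul, norm_inv, norm_pow, RCLike.norm_ofNat, one_div, inv_pow]
    exact mul_le_of_le_one_right (by positivity) hy
  obtain ⟨T, hTfin, hT⟩ := hAP _ (hcomp.union hs) δ hδ
  obtain ⟨t, rfl⟩ := exists_tensorToOp_eq T hTfin
  refine ⟨t, fun e he => hT e (Or.inr he), ?_⟩
  have hTC : ∀ n k, x k ∈ C n → ‖tensorToOp E t (x k)‖ ≤ 1 + δ * 2 ^ n := by
    intro n k hk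
    have h1 := hT ((((2 : ℂ) ^ n)⁻¹) • x k) (Or.inl (subset_closure (mem_iUnion.2
      ⟨n, x k, ⟨hk, by simpa using hx1 k⟩, rfl⟩)))
    rw [map_smul, ← smul_sub, norm_smul, norm_inv, norm_pow, RCLike.norm_ofNat,
      inv_mul_lt_iff₀ (by positivity)] at h1
    have h2 : ‖tensorToOp E t (x k)‖ ≤ ‖tensorToOp E t (x k) - x k‖ + ‖x k‖ := by
      simpa using norm_add_le (tensorToOp E t (x k) - x k) (x k)
    linarith [hx1 k]
  have hpt : ∀ k, ENNReal.ofReal ‖tensorToOp E t (x k)‖ ≤ ENNReal.ofReal (1 + δ) +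
      ∑' n : ℕ, {k | x k ∉ C n}.indicator (fun _ => ENNReal.ofReal δ * 2 ^ (n + 1)) k := by
    intro k
    have hterm : ∀ n, x k ∉ C n → ENNReal.ofReal (δ * 2 ^ (n + 1)) ≤
        ∑' n : ℕ, {k | x k ∉ C n}.indicator (fun _ => ENNReal.ofReal δ * 2 ^ (n + 1)) k := by
      intro n hn
      refine le_trans ?_ (ENNReal.le_tsum n)
      rw [indicator_of_mem (show k ∈ {k | x k ∉ C n} from hn), ENNReal.ofReal_mul hδ.le,
        ENNReal.ofReal_pow (by norm_num), ENNReal.ofReal_ofNat]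
    -- If `n + 1` is the first index with `x k ∈ C (n + 1)`, the bound `1 + δ * 2 ^ (n + 1)` is paid
    -- by the `n`th term, since `x k ∉ C n`. If there is no such index, every term is present and
    -- the sum is infinite.
    by_cases h : ∃ n, x k ∈ C n
    · classical
      rcases hn : Nat.find h with _ | n
      · have h0 : x k ∈ C 0 := hn ▸ Nat.find_spec h
        refine le_add_right (ENNReal.ofReal_le_ofReal ?_)
        simpa using hTC 0 k h0
      · have h1 : x k ∈ C (n + 1) := hn ▸ Nat.find_spec h
        have h2 : x k ∉ C n := Nat.find_min h (by omega)
        refine (ENNReal.ofReal_le_ofReal (hTC _ k h1)).trans ?_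
        rw [ENNReal.ofReal_add (by norm_num) (by positivity)]
        exact add_le_add (ENNReal.ofReal_le_ofReal (by linarith)) (hterm n h2)
    · push Not at h
      obtain ⟨n, hn⟩ := pow_unbounded_of_one_lt (‖tensorToOp E t (x k)‖ / δ) one_lt_two
      refine le_add_left (le_trans (ENNReal.ofReal_le_ofReal ?_) (hterm n (h n)))
      rw [div_lt_iff₀' hδ] at hn
      have : (0 : ℝ) < 2 ^ n := by positivity
      rw [pow_succ]
      nlinarith
  have hlint : ∫⁻ k, ENNReal.ofReal ‖tensorToOp E t (x k)‖ ∂μ ≤ ENNReal.ofReal (1 + 2 * δ) := by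
    calc ∫⁻ k, ENNReal.ofReal ‖tensorToOp E t (x k)‖ ∂μ
        ≤ ∫⁻ k, (ENNReal.ofReal (1 + δ) + ∑' n : ℕ,
            {k | x k ∉ C n}.indicator (fun _ => ENNReal.ofReal δ * 2 ^ (n + 1)) k) ∂μ :=
          lintegral_mono hpt
      _ = ENNReal.ofReal (1 + δ) * μ univ +
            ∑' n : ℕ, ENNReal.ofReal δ * 2 ^ (n + 1) * μ {k | x k ∉ C n} := by
          have hm : ∀ n, MeasurableSet {k | x k ∉ C n} := fun n => (hCm n).compl
          rw [lintegral_add_left measurable_const, lintegral_const, lintegral_tsum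
            (fun n => (measurable_const.indicator (hm n)).aemeasurable)]
          simp_rw [lintegral_indicator_const (hm _)]
      _ ≤ ENNReal.ofReal (1 + δ) * 1 + ∑' n : ℕ, ENNReal.ofReal δ * w n := by
          refine add_le_add (by gcongr) (ENNReal.tsum_le_tsum fun n => ?_)
          calc ENNReal.ofReal δ * 2 ^ (n + 1) * μ {k | x k ∉ C n}
              ≤ ENNReal.ofReal δ * 2 ^ (n + 1) * (w n / 2 ^ (n + 1)) := by
                gcongr
                exact hCμ n
            _ = ENNReal.ofReal δ * w n := by
                rw [mul_assoc, ENNReal.mul_div_cancel (by simp) (by simp)]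
      _ ≤ ENNReal.ofReal (1 + δ) * 1 + ENNReal.ofReal δ * 1 := by
          rw [ENNReal.tsum_mul_left]
          gcongr
      _ = ENNReal.ofReal (1 + 2 * δ) := by
          rw [mul_one, mul_one, ← ENNReal.ofReal_add (by positivity) hδ.le]
          ring_nf
  rw [integral_eq_lintegral_of_nonneg_ae (Eventually.of_forall fun k => norm_nonneg _)
    (continuous_tensorToOp hx t).norm.aestronglyMeasurable]
  exact ENNReal.toReal_le_of_le_ofReal (by positivity) hlint

/-- On a reflexive space with the approximation property, the trace of an element of the
projective tensor product is bounded by its norm as a functional on the finite rank operators. -/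
theorem IsReflexive.norm_trace_le {E : Type*} [NormedAddCommGroup E] [NormedSpace ℂ E]
    [CompleteSpace E] (hE : IsReflexive E) (hAP : HasApproximationProperty E)
    {ι : Type*} (I : Finset ι) (e : ι → E) (ψ : ι → StrongDual ℂ E) {κ : ℝ} (hκ : 0 < κ)
    (h : ∀ t, ‖∑ i ∈ I, ψ i (tensorToOp E t (e i))‖ ≤ κ * ‖tensorToOp E t‖) :
    ‖∑ i ∈ I, ψ i (e i)‖ ≤ κ := by
  -- The unit ball of `E` with its weak topology, realized as the weak-star compact ball of the
  -- bidual.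
  let K : Type _ := ↥((WeakDual.toStrongDual (𝕜 := ℂ) (E := StrongDual ℂ E)) ⁻¹'
    Metric.closedBall 0 1)
  have : CompactSpace K := isCompact_iff_compactSpace.1 (WeakDual.isCompact_closedBall 0 1)
  have : T2Space K := inferInstance
  let _ : MeasurableSpace K := borel K
  have : BorelSpace K := ⟨rfl⟩
  have hxex : ∀ k : K, ∃ v : E, ‖v‖ ≤ 1 ∧ ∀ f : StrongDual ℂ E, f v = k.1 f := fun k => by
    obtain ⟨v, hv, hvf⟩ := hE.exists_eval (WeakDual.toStrongDual k.1)
    exact ⟨v, by rw [hv]; exact mem_closedBall_zero_iff.1 k.2, hvf⟩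
  choose x hx1 hxf using hxex
  have hx : ∀ f : StrongDual ℂ E, Continuous fun k => f (x k) := fun f => by
    simp only [hxf]
    exact (WeakDual.eval_continuous f).comp continuous_subtype_val
  have hsurj : ∀ v : E, ‖v‖ ≤ 1 → ∃ k, x k = v := by
    intro v hv
    refine ⟨⟨WeakDual.toStrongDual.symm (NormedSpace.inclusionInDoubleDual ℂ E v), ?_⟩, ?_⟩
    · simpa using (NormedSpace.double_dual_bound ℂ E v).trans hv
    · exact (SeparatingDual.eq_iff_forall_dual_eq (R := ℂ)).2 fun f => hxf _ f
  have : Nonempty K := ⟨(hsurj 0 (by simp)).choose⟩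
  let W : E ⊗[ℂ] StrongDual ℂ E →ₗ[ℂ] ℂ :=
    ∑ i ∈ I, (ψ i : E →ₗ[ℂ] ℂ) ∘ₗ (ContinuousLinearMap.apply ℂ E (e i)).toLinearMap ∘ₗ tensorToOp E
  have hW : ∀ t, W t = ∑ i ∈ I, ψ i (tensorToOp E t (e i)) := fun t => by simp [W]
  obtain ⟨μ, hμf, hμr, hμ1, hμ⟩ := exists_measure_dominating (K := K)
    (κ⁻¹ • (Complex.reLm ∘ₗ W.restrictScalars ℝ))
    (fun t => ⟨fun k => ‖tensorToOp E t (x k)‖, (continuous_tensorToOp hx t).norm⟩)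
    (fun s t k => by simpa using norm_add_le _ _)
    (fun c hc t k => by
      have : c • t = (c : ℂ) • t := rfl
      simp [this, norm_smul, abs_of_pos hc])
    (fun t c hc => by
      have hc0 : 0 ≤ c := (norm_nonneg (tensorToOp E t (x _))).trans (hc (Classical.arbitrary K))
      have h1 : ‖tensorToOp E t‖ ≤ c := by
        refine ContinuousLinearMap.opNorm_le_of_unit_norm hc0 fun v hv => ?_
        obtain ⟨k, rfl⟩ := hsurj v hv.le
        exact hc k
      have h2 : (W t).re ≤ κ * c := (Complex.re_le_norm _).trans (by
        rw [hW]; exact (h t).trans (by gcongr))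
      change κ⁻¹ * (W t).re ≤ c
      rwa [inv_mul_le_iff₀ hκ])
  refine le_of_forall_pos_le_add fun ε hε => ?_
  set M : ℝ := ∑ i ∈ I, ‖ψ i‖ with hM
  have hM0 : 0 ≤ M := Finset.sum_nonneg fun _ _ => norm_nonneg _
  set δ : ℝ := ε / (M + 2 * κ) with hδ
  have hδ0 : 0 < δ := by positivity
  obtain ⟨t, hte, htμ⟩ := hE.exists_approx hAP μ hμ1 hx hx1
    ((I.finite_toSet.image e).isCompact) hδ0
  set z : ℂ := ∑ i ∈ I, ψ i (e i) with hz
  have hzW : ‖z - W t‖ ≤ M * δ := by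
    rw [hW, hz, ← Finset.sum_sub_distrib, hM, Finset.sum_mul]
    refine (norm_sum_le _ _).trans (Finset.sum_le_sum fun i hi => ?_)
    rw [← map_sub]
    refine ((ψ i).le_opNorm _).trans ?_
    rw [norm_sub_rev]
    gcongr
    exact (hte _ ⟨i, hi, rfl⟩).le
  obtain ⟨c, hc, hcz⟩ : ∃ c : ℂ, ‖c‖ = 1 ∧ ‖W t‖ = c * W t := by
    obtain ⟨c, hc, h⟩ := RCLike.exists_norm_eq_mul_self (W t)
    exact ⟨c, hc, h⟩
  -- The domination bounds only real parts, so `t` is rotated by a unimodular scalar.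
  have hWt : ‖W t‖ ≤ κ * (1 + 2 * δ) := by
    have h1 := hμ (c • t)
    have h2 : ((κ⁻¹ • (Complex.reLm ∘ₗ W.restrictScalars ℝ)) (c • t) : ℝ) = κ⁻¹ * ‖W t‖ := by
      change κ⁻¹ * (W (c • t)).re = _
      rw [map_smul, smul_eq_mul, ← hcz, Complex.ofReal_re]
    rw [h2] at h1
    have h3 : ∫ k, ‖tensorToOp E (c • t) (x k)‖ ∂μ = ∫ k, ‖tensorToOp E t (x k)‖ ∂μ := by
      congr 1 with k
      rw [map_smul, smul_apply, norm_smul, hc, one_mul]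
    have h4 : κ⁻¹ * ‖W t‖ ≤ 1 + 2 * δ := (h1.trans h3.le).trans htμ
    rwa [inv_mul_le_iff₀ hκ] at h4
  have hfin : ‖z‖ ≤ ‖W t‖ + ‖z - W t‖ := by simpa using norm_add_le (W t) (z - W t)
  have : δ * (M + 2 * κ) = ε := by rw [hδ]; field_simp
  nlinarith

end Approximation

/-! ### Operators obtained from trace estimates. -/

/-- An operator into the bidual of a reflexive space comes from an operator into the space. -/
theorem IsReflexive.exists_operator {A E : Type*} [NormedAddCommGroup A] [NormedSpace ℂ A]
    [NormedAddCommGroup E] [NormedSpace ℂ E] (hA : IsReflexive A)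
    (B : E →L[ℂ] StrongDual ℂ (StrongDual ℂ A)) :
    ∃ Q : E →L[ℂ] A, ∀ e (g : StrongDual ℂ A), g (Q e) = B e g := by
  let J := LinearIsometryEquiv.ofSurjective (NormedSpace.inclusionInDoubleDualLi ℂ (E := A)) hA
  refine ⟨(J.symm.toContinuousLinearEquiv : _ →L[ℂ] A).comp B, fun e g => ?_⟩
  have h : J (J.symm (B e)) = B e := J.apply_symm_apply _
  exact congrArg (fun Θ : StrongDual ℂ (StrongDual ℂ A) => Θ g) h

theorem exists_dual_factor {M Y : Type*} [AddCommGroup M] [Module ℂ M] [NormedAddCommGroup Y]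
    [NormedSpace ℂ Y] (j : M →ₗ[ℂ] Y) (T : M →ₗ[ℂ] ℂ) (C : ℝ) (h : ∀ u, ‖T u‖ ≤ C * ‖j u‖) :
    ∃ τ : StrongDual ℂ Y, ∀ u, τ (j u) = T u := by
  have hker : LinearMap.ker j ≤ LinearMap.ker T := fun u hu => by
    rw [LinearMap.mem_ker] at hu ⊢
    simpa [hu] using h u
  let T₀ : LinearMap.range j →ₗ[ℂ] ℂ :=
    (LinearMap.ker j).liftQ T hker ∘ₗ j.quotKerEquivRange.symm.toLinearMap
  have hT₀ : ∀ u, T₀ ⟨j u, u, rfl⟩ = T u := fun u => by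
    have : j.quotKerEquivRange.symm ⟨j u, u, rfl⟩ = (LinearMap.ker j).mkQ u :=
      j.quotKerEquivRange_symm_apply_image u ⟨u, rfl⟩
    simp only [T₀, LinearMap.comp_apply, LinearEquiv.coe_coe, this]
    rfl
  obtain ⟨τ, hτ, -⟩ := exists_extension_norm_eq (LinearMap.range j) (T₀.mkContinuous C (by
    rintro ⟨_, u, rfl⟩
    rw [hT₀]
    exact h u))
  exact ⟨τ, fun u => (hτ ⟨j u, u, rfl⟩).trans (hT₀ u)⟩

theorem exists_preimage_norm_le_of_isOpenMap {X Y : Type*} [NormedAddCommGroup X]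
    [NormedSpace ℂ X] [NormedAddCommGroup Y] [NormedSpace ℂ Y] {T : X →L[ℂ] Y}
    (hT : IsOpenMap T) : ∃ C : ℝ, 0 < C ∧ ∀ y, ∃ x, T x = y ∧ ‖x‖ ≤ C * ‖y‖ := by
  have h := hT.image_mem_nhds (Metric.ball_mem_nhds (0 : X) one_pos)
  rw [map_zero] at h
  obtain ⟨δ, hδ, hsub⟩ := Metric.mem_nhds_iff.1 h
  -- The factor 2 scales `y` to norm `δ / 2`, strictly inside the open ball.
  refine ⟨2 / δ, by positivity, fun y => ?_⟩
  rcases eq_or_ne y 0 with rfl | hy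
  · exact ⟨0, by simp, by simp⟩
  have hy0 : 0 < ‖y‖ := norm_pos_iff.2 hy
  set c : ℝ := 2 / δ * ‖y‖ with hc
  have hc0 : 0 < c := by positivity
  obtain ⟨x, hx, hxy⟩ : ((c : ℂ)⁻¹) • y ∈ T '' Metric.ball 0 1 := by
    refine hsub ?_
    rw [mem_ball_zero_iff, norm_smul, norm_inv, Complex.norm_real, Real.norm_of_nonneg hc0.le,
      inv_mul_lt_iff₀ hc0, hc]
    field_simp
    norm_num
  refine ⟨(c : ℂ) • x, ?_, ?_⟩
  · rw [map_smul, hxy, smul_inv_smul₀]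
    exact_mod_cast hc0.ne'
  · rw [norm_smul, Complex.norm_real, Real.norm_of_nonneg hc0.le]
    exact mul_le_of_le_one_right hc0.le (mem_ball_zero_iff.1 hx).le

/-- The functional `w ↦ w g (c e)` on bilinear forms. -/
def formEval {X E G : Type*} [NormedAddCommGroup X] [NormedSpace ℂ X] [NormedAddCommGroup E]
    [NormedSpace ℂ E] [NormedAddCommGroup G] [NormedSpace ℂ G] (c : E →L[ℂ] G) :
    E →L[ℂ] X →L[ℂ] StrongDual ℂ (X →L[ℂ] StrongDual ℂ G) :=
  LinearMap.mkContinuous₂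
    (LinearMap.mk₂ ℂ
      (fun e g => (ContinuousLinearMap.apply ℂ ℂ (c e)).comp
        (ContinuousLinearMap.apply ℂ (StrongDual ℂ G) g))
      (fun e e' g => by ext w; simp) (fun a e g => by ext w; simp)
      (fun e g g' => by ext w; simp) (fun a e g => by ext w; simp)) ‖c‖
    (fun e g => by
      refine ContinuousLinearMap.opNorm_le_bound _ (by positivity) fun w => ?_
      calc ‖w g (c e)‖ ≤ ‖w‖ * ‖g‖ * ‖c e‖ := w.le_opNorm₂ _ _
        _ ≤ ‖w‖ * ‖g‖ * (‖c‖ * ‖e‖) := by gcongr; exact c.le_opNorm e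
        _ = ‖c‖ * ‖e‖ * ‖g‖ * ‖w‖ := by ring)

/-- An extension of a map prescribed on a subspace `F` of the dual of a reflexive space, given
a trace estimate in terms of bilinear forms. -/
theorem IsReflexive.exists_operator_of_trace_le {A E F G : Type*} [NormedAddCommGroup A]
    [NormedSpace ℂ A] [NormedAddCommGroup E] [NormedSpace ℂ E] [NormedAddCommGroup F]
    [NormedSpace ℂ F] [NormedAddCommGroup G] [NormedSpace ℂ G] (hA : IsReflexive A)
    (c : E →L[ℂ] G) (i : F →ₗ[ℂ] StrongDual ℂ A) (p : F →ₗ[ℂ] StrongDual ℂ E) (C : ℝ)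
    (h : ∀ (I : Finset (E × F)) (κ : ℝ), 0 ≤ κ →
      (∀ w : StrongDual ℂ A →L[ℂ] StrongDual ℂ G, ‖∑ q ∈ I, w (i q.2) (c q.1)‖ ≤ κ * ‖w‖) →
      ‖∑ q ∈ I, p q.2 q.1‖ ≤ C * κ) :
    ∃ Q : E →L[ℂ] A, ∀ e ψ, i ψ (Q e) = p ψ e := by
  let j : E ⊗[ℂ] F →ₗ[ℂ] StrongDual ℂ (StrongDual ℂ A →L[ℂ] StrongDual ℂ G) :=
    TensorProduct.lift (LinearMap.mk₂ ℂ (fun e ψ => formEval c e (i ψ))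
      (fun e e' g => by simp) (fun c e g => by simp)
      (fun e g g' => by simp) (fun c e g => by simp))
  let tr : E ⊗[ℂ] F →ₗ[ℂ] ℂ :=
    TensorProduct.lift (LinearMap.mk₂ ℂ (fun e ψ => p ψ e)
      (fun e e' g => by simp) (fun c e g => by simp)
      (fun e g g' => by simp) (fun c e g => by simp))
  have hj : ∀ e ψ, j (e ⊗ₜ ψ) = formEval c e (i ψ) := fun e ψ => rfl
  have htr : ∀ e ψ, tr (e ⊗ₜ ψ) = p ψ e := fun e ψ => rfl
  obtain ⟨τ, hτ⟩ := exists_dual_factor j tr C (fun u => by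
    obtain ⟨I, rfl⟩ := TensorProduct.exists_finset u
    simp only [map_sum, htr]
    refine h I _ (norm_nonneg _) fun w => ?_
    refine le_trans (le_of_eq ?_) (ContinuousLinearMap.le_opNorm _ w)
    rw [sum_apply]
    rfl)
  obtain ⟨Q, hQ⟩ := hA.exists_operator
    ((ContinuousLinearMap.compL ℂ (StrongDual ℂ A) _ ℂ τ).comp (formEval c))
  refine ⟨Q, fun e ψ => ?_⟩
  rw [hQ]
  exact (hτ (e ⊗ₜ ψ)).trans (htr e ψ)

/-! ### A bounded right inverse of the quotient map. -/

section Lift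

variable {A E F : Type*} [NormedAddCommGroup A] [NormedSpace ℂ A] [NormedAddCommGroup E]
  [NormedSpace ℂ E] [NormedAddCommGroup F] [NormedSpace ℂ F]

/-- The evaluations at the points of `E` on a space `F` mapped to the dual of `E`. -/
def evalThrough (p : F →L[ℂ] StrongDual ℂ E) : E →L[ℂ] StrongDual ℂ F :=
  (ContinuousLinearMap.precomp ℂ p).comp (NormedSpace.inclusionInDoubleDual ℂ E)

@[simp]
theorem evalThrough_apply (p : F →L[ℂ] StrongDual ℂ E) (e : E) (ψ : F) :
    evalThrough p e ψ = p ψ e := rfl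

theorem tensorToBilin_evalThrough (p : F →L[ℂ] StrongDual ℂ E) (t : E ⊗[ℂ] F)
    (φ : StrongDual ℂ E) (e : E) :
    tensorToBilin _ _ t φ (evalThrough p e) =
      φ (tensorToOp _ (TensorProduct.map LinearMap.id (p : F →ₗ[ℂ] StrongDual ℂ E) t) e) := by
  induction t using TensorProduct.induction_on with
  | zero => simp
  | tmul a ψ => simp [mul_comm]
  | add s t hs ht => simp only [map_add, add_apply, hs, ht]

/-- The injective norm is at most the operator norm. -/
theorem norm_tensorToBilin_le (p : F →L[ℂ] StrongDual ℂ E)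
    (hF : ∀ ξ : StrongDual ℂ F, ∃ e : E, ‖e‖ ≤ ‖ξ‖ ∧ evalThrough p e = ξ) (t : E ⊗[ℂ] F) :
    ‖tensorToBilin _ _ t‖ ≤
      ‖tensorToOp _ (TensorProduct.map LinearMap.id (p : F →ₗ[ℂ] StrongDual ℂ E) t)‖ := by
  refine ContinuousLinearMap.opNorm_le_bound₂ _ (norm_nonneg _) fun φ ξ => ?_
  obtain ⟨e, he, rfl⟩ := hF ξ
  rw [tensorToBilin_evalThrough]
  set T := tensorToOp _ (TensorProduct.map LinearMap.id (p : F →ₗ[ℂ] StrongDual ℂ E) t)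
  calc ‖φ (T e)‖ ≤ ‖φ‖ * (‖T‖ * ‖e‖) :=
        (φ.le_opNorm _).trans (by gcongr; exact T.le_opNorm _)
    _ ≤ ‖φ‖ * (‖T‖ * ‖evalThrough p e‖) := by gcongr
    _ = ‖T‖ * ‖φ‖ * ‖evalThrough p e‖ := by ring

theorem IsReflexive.exists_rightInverse [CompleteSpace E] (hA : IsReflexive A)
    (hE : IsReflexive E) (hAP : HasApproximationProperty E) (π : A →L[ℂ] E)
    (p : F →L[ℂ] StrongDual ℂ E) (hp : Function.Surjective p)
    (hF : ∀ ξ : StrongDual ℂ F, ∃ e : E, ‖e‖ ≤ ‖ξ‖ ∧ evalThrough p e = ξ)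
    (hopen : IsOpenMap (InjectiveTensor.map π (ContinuousLinearMap.id ℂ F))) :
    ∃ Q : E →L[ℂ] A, ∀ e, π (Q e) = e := by
  obtain ⟨C, hC, hlift⟩ := exists_preimage_norm_le_of_isOpenMap
    (X := InjectiveTensor A F) (Y := InjectiveTensor E F)
    (T := InjectiveTensor.map π (ContinuousLinearMap.id ℂ F)) hopen
  obtain ⟨Q, hQ⟩ := hA.exists_operator_of_trace_le (evalThrough p)
    (((ContinuousLinearMap.precomp ℂ π).comp p : F →L[ℂ] StrongDual ℂ A) : F →ₗ[ℂ] StrongDual ℂ A)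
    (p : F →ₗ[ℂ] StrongDual ℂ E) C fun I κ hκ hI => by
      refine le_of_forall_pos_le_add fun ε hε => ?_
      -- The slack `ε` provides the strictly positive constant needed here, as `κ` may vanish.
      refine hE.norm_trace_le hAP I (fun q => q.1) (fun q => p q.2) (by positivity) fun t => ?_
      obtain ⟨t, rfl⟩ : ∃ t', TensorProduct.map (LinearMap.id : E →ₗ[ℂ] E)
          (p : F →ₗ[ℂ] StrongDual ℂ E) t' = t :=
        TensorProduct.map_surjective Function.surjective_id hp t
      set T := tensorToOp _ (TensorProduct.map LinearMap.id (p : F →ₗ[ℂ] StrongDual ℂ E) t) with hT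
      let v : InjectiveTensor E F :=
        ⟨tensorToBilin _ _ t, Submodule.le_topologicalClosure _ ⟨t, rfl⟩⟩
      obtain ⟨w, hw, hwn⟩ := hlift v
      have hvT : ‖v‖ ≤ ‖T‖ := norm_tensorToBilin_le p hF t
      -- As `w` lifts `T` along `π ⊗ id`, pairing `T` with the tensor equals pairing `w` with its
      -- image, where `hI` applies.
      have hsum : ∑ q ∈ I, p q.2 (T q.1) =
          ∑ q ∈ I, w.1 ((p q.2).comp π) (evalThrough p q.1) := by
        refine Finset.sum_congr rfl fun q _ => ?_
        rw [hT, ← tensorToBilin_evalThrough]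
        exact congrArg (fun v : InjectiveTensor E F => v.1 (p q.2) (evalThrough p q.1)) hw.symm
      rw [hsum]
      calc _ ≤ κ * ‖w‖ := hI w.1
        _ ≤ κ * (C * ‖T‖) := by gcongr; exact hwn.trans (by gcongr)
        _ = C * κ * ‖T‖ := by ring
        _ ≤ (C * κ + ε) * ‖T‖ := by gcongr; linarith
  refine ⟨Q, fun e => (SeparatingDual.eq_iff_forall_dual_eq (R := ℂ)).2 fun f => ?_⟩
  obtain ⟨ψ, rfl⟩ := hp f
  exact hQ e ψ

/-- If `A` is reflexive, the quotient has the approximation property and the tensored quotient map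
is open, then the quotient map has a bounded right inverse. -/
theorem IsReflexive.exists_rightInverse_mkQL [CompleteSpace A] (hA : IsReflexive A)
    (L : Submodule ℂ A) [IsClosed (L : Set A)] (hAP : HasApproximationProperty (A ⧸ L))
    (hopen : IsOpenMap (InjectiveTensor.map L.mkQL
      (ContinuousLinearMap.id ℂ (StrongDual.polarSubmodule ℂ L)))) :
    ∃ Q : (A ⧸ L) →L[ℂ] A, ∀ e, L.mkQL (Q e) = e :=
  hA.exists_rightInverse (hA.quotient L) hAP L.mkQL (polarLift L) (polarLift_surjective L)
    (fun ξ => by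
      obtain ⟨a, ha, hξ⟩ := hA.exists_eval_of_subspace _ ξ
      exact ⟨L.mkQL a, (Submodule.Quotient.norm_mk_le L a).trans ha.le, by ext ψ; exact hξ ψ⟩)
    hopen

end Lift

/-! ### Consequences of amenability: a unit and module sections. -/

section Amenable

universe u

variable {A : Type u} [NonUnitalNormedRing A] [NormedSpace ℂ A] [IsScalarTower ℂ A A]
  [SMulCommClass ℂ A A]

theorem eq_of_forall_dual_eq {E : Type*} [NormedAddCommGroup E] [NormedSpace ℂ E] {x y : E}
    (h : ∀ f : StrongDual ℂ E, f x = f y) : x = y :=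
  (SeparatingDual.eq_iff_forall_dual_eq (R := ℂ)).2 h

/-- A reflexive amenable Banach algebra is unital. -/
theorem IsAmenable.exists_unit (hamen : IsAmenable A) (hrefl : IsReflexive A) :
    ∃ e : A, (∀ a, e * a = a) ∧ ∀ a, a * e = a := by
  let lin : (A →L[ℂ] A) →L[ℂ] StrongDual ℂ A →L[ℂ] StrongDual ℂ A :=
    (ContinuousLinearMap.compL ℂ A A ℂ).flip
  -- With the left action zero, the inclusion into the bidual is a derivation; if `Θ` implements it
  -- and `r` represents `Θ`, then `a = a * r`. The mirror module `ML` gives `a = -l * a`.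
  let MR : BanachBimodule A (StrongDual ℂ A) :=
    { left := 0
      right := lin.comp (ContinuousLinearMap.mul ℂ A)
      left_mul := fun a b f => by simp
      right_mul := fun a b f => by ext x; simp [lin, mul_assoc]
      left_right := fun a b f => by simp }
  let ML : BanachBimodule A (StrongDual ℂ A) :=
    { left := lin.comp (ContinuousLinearMap.mul ℂ A).flip
      right := 0
      left_mul := fun a b f => by ext x; simp [lin, mul_assoc]
      right_mul := fun a b f => by simp
      left_right := fun a b f => by simp }
  obtain ⟨Θ, hΘ⟩ := hamen _ MR (NormedSpace.inclusionInDoubleDual ℂ A) (fun a b => by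
    ext f; simp [BanachBimodule.dualLeft, BanachBimodule.dualRight, MR, lin])
  obtain ⟨Ξ, hΞ⟩ := hamen _ ML (NormedSpace.inclusionInDoubleDual ℂ A) (fun a b => by
    ext f; simp [BanachBimodule.dualLeft, BanachBimodule.dualRight, ML, lin])
  obtain ⟨r, -, hr⟩ := hrefl.exists_eval Θ
  obtain ⟨l, -, hl⟩ := hrefl.exists_eval Ξ
  have hright : ∀ a, a * r = a := fun a => eq_of_forall_dual_eq fun f => by
    have h := congrArg (fun Φ : StrongDual ℂ (StrongDual ℂ A) => Φ f) (hΘ a)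
    simp [BanachBimodule.dualLeft, BanachBimodule.dualRight, MR, ← hr, lin] at h
    exact h.symm
  have hleft : ∀ a, -l * a = a := fun a => eq_of_forall_dual_eq fun f => by
    have h := congrArg (fun Φ : StrongDual ℂ (StrongDual ℂ A) => Φ f) (hΞ a)
    simp [BanachBimodule.dualLeft, BanachBimodule.dualRight, ML, ← hl, lin] at h
    rw [h, neg_mul, map_neg]
  have : -l = r := by rw [← hright (-l), hleft]
  exact ⟨r, fun a => by rw [← this, hleft], hright⟩

section Section

variable (L : Submodule ℂ A)

/-- Left multiplication on a left ideal. -/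
def idealMul (hL : IsLeftIdeal L) : A →L[ℂ] L →L[ℂ] L :=
  LinearMap.mkContinuous₂
    (LinearMap.mk₂ ℂ (fun a x => ⟨a * x, hL a x x.2⟩)
      (fun a b x => Subtype.ext (add_mul a b _)) (fun c a x => Subtype.ext (smul_mul_assoc c a _))
      (fun a x y => Subtype.ext (mul_add a _ _)) (fun c a x => Subtype.ext (mul_smul_comm c a _))) 1
    (fun a x => by
      rw [one_mul]
      exact norm_mul_le a (x : A))

variable [IsClosed (L : Set A)]

/-- Left multiplication on the quotient by a left ideal. -/
def quotMul (hL : IsLeftIdeal L) : A →L[ℂ] (A ⧸ L) →L[ℂ] (A ⧸ L) :=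
  LinearMap.mkContinuous₂
    (LinearMap.mk₂ ℂ (fun a q => L.liftQL (L.mkQL.comp (ContinuousLinearMap.mul ℂ A a))
        (fun x hx => (Submodule.Quotient.mk_eq_zero L).2 (hL a x hx)) q)
      (fun a b q => by
        obtain ⟨x, rfl⟩ := L.mkQ_surjective q
        exact congrArg L.mkQ (add_mul a b x))
      (fun c a q => by
        obtain ⟨x, rfl⟩ := L.mkQ_surjective q
        exact congrArg L.mkQ (smul_mul_assoc c a x))
      (fun a q q' => map_add _ _ _) (fun c a q => map_smul _ _ _)) 1
    (fun a q => by
      refine le_of_forall_pos_lt_add fun ε hε => ?_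
      obtain ⟨m, rfl, hm⟩ := Submodule.Quotient.norm_mk_lt (S := L) q
        (div_pos hε (by positivity : 0 < ‖a‖ + 1))
      calc ‖(Submodule.Quotient.mk (a * m) : A ⧸ L)‖ ≤ ‖a * m‖ := Submodule.Quotient.norm_mk_le L _
        _ ≤ ‖a‖ * ‖m‖ := norm_mul_le _ _
        _ ≤ ‖a‖ * (‖(Submodule.Quotient.mk m : A ⧸ L)‖ + ε / (‖a‖ + 1)) := by gcongr
        _ = 1 * ‖a‖ * ‖(Submodule.Quotient.mk m : A ⧸ L)‖ + ε * (‖a‖ / (‖a‖ + 1)) := by ring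
        _ < 1 * ‖a‖ * ‖(Submodule.Quotient.mk m : A ⧸ L)‖ + ε := by
          have : ‖a‖ / (‖a‖ + 1) < 1 := by rw [div_lt_one (by positivity)]; linarith
          nlinarith)

@[simp]
theorem quotMul_mkQL (hL : IsLeftIdeal L) (a x : A) :
    quotMul L hL a (L.mkQL x) = L.mkQL (a * x) := rfl

theorem quotMul_mul (hL : IsLeftIdeal L) (a b : A) (q : A ⧸ L) :
    quotMul L hL (a * b) q = quotMul L hL a (quotMul L hL b q) := by
  obtain ⟨x, rfl⟩ := L.mkQ_surjective q
  exact congrArg L.mkQ (mul_assoc a b x)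

theorem mkQL_mul (hL : IsLeftIdeal L) (a x : A) :
    L.mkQL (a * x) = quotMul L hL a (L.mkQL x) := rfl

/-- The dual of the bounded operators from the quotient by `L` to `L`, as a Banach bimodule. -/
def operatorBimodule (hL : IsLeftIdeal L) : BanachBimodule A (StrongDual ℂ ((A ⧸ L) →L[ℂ] L)) where
  left := ((ContinuousLinearMap.compL ℂ ((A ⧸ L) →L[ℂ] L) ((A ⧸ L) →L[ℂ] L) ℂ).flip).comp
    (((ContinuousLinearMap.compL ℂ (A ⧸ L) (A ⧸ L) L).flip).comp (quotMul L hL))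
  right := ((ContinuousLinearMap.compL ℂ ((A ⧸ L) →L[ℂ] L) ((A ⧸ L) →L[ℂ] L) ℂ).flip).comp
    ((ContinuousLinearMap.compL ℂ (A ⧸ L) L L).comp (idealMul L hL))
  left_mul a b ξ := by
    ext T
    refine congrArg ξ ?_
    ext q
    exact congrArg (fun x => (T x : A)) (quotMul_mul L hL a b q)
  right_mul a b ξ := by
    ext T
    refine congrArg ξ ?_
    ext q
    exact mul_assoc a b _
  left_right a b ξ := rfl

variable {L} in
/-- The commutator `a ↦ a Q - Q a` of a right inverse of the quotient map. -/
def sectionCommutator (hL : IsLeftIdeal L) (Q : (A ⧸ L) →L[ℂ] A) (hQ : ∀ e, L.mkQL (Q e) = e) :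
    A →L[ℂ] (A ⧸ L) →L[ℂ] L :=
  LinearMap.mkContinuous₂
    (LinearMap.mk₂ ℂ (fun a q => ⟨a * Q q - Q (quotMul L hL a q), by
        rw [← Submodule.Quotient.mk_eq_zero]
        change L.mkQL _ = 0
        rw [map_sub, mkQL_mul L hL, hQ, hQ, sub_self]⟩)
      (fun a b q => Subtype.ext (by simp [add_mul]; abel))
      (fun c a q => Subtype.ext (by simp [smul_sub, smul_mul_assoc c a (Q q)]))
      (fun a q q' => Subtype.ext (by simp [mul_add]; abel))
      (fun c a q => Subtype.ext (by simp [smul_sub, mul_smul_comm c a (Q q)]))) (‖Q‖ + ‖Q‖ * ‖quotMul L hL‖)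
    (fun a q => by
      calc ‖a * Q q - Q (quotMul L hL a q)‖ ≤ ‖a * Q q‖ + ‖Q (quotMul L hL a q)‖ := norm_sub_le _ _
        _ ≤ ‖a‖ * (‖Q‖ * ‖q‖) + ‖Q‖ * (‖quotMul L hL‖ * ‖a‖ * ‖q‖) := by
          refine add_le_add ((norm_mul_le _ _).trans ?_) ((Q.le_opNorm _).trans ?_)
          · gcongr; exact Q.le_opNorm q
          · gcongr; exact (quotMul L hL).le_opNorm₂ a q
        _ = (‖Q‖ + ‖Q‖ * ‖quotMul L hL‖) * ‖a‖ * ‖q‖ := by ring)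

/-- Over a reflexive amenable Banach algebra, a complemented closed left ideal is complemented as
a left module. -/
theorem IsAmenable.exists_module_section (hamen : IsAmenable A) (hrefl : IsReflexive A)
    [CompleteSpace A] (hL : IsLeftIdeal L) (Q : (A ⧸ L) →L[ℂ] A) (hQ : ∀ e, L.mkQL (Q e) = e) :
    ∃ ρ : (A ⧸ L) →L[ℂ] A, (∀ e, L.mkQL (ρ e) = e) ∧
      ∀ a e, ρ (quotMul L hL a e) = a * ρ e := by
  -- The commutator `a ↦ a Q - Q a` takes values in operators into `L`, as `Q` is a section. It is a
  -- derivation into their bidual, where amenability applies.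
  obtain ⟨Θ, hΘ⟩ := hamen _ (operatorBimodule L hL)
    ((NormedSpace.inclusionInDoubleDual ℂ _).comp (sectionCommutator hL Q hQ)) (fun a b => by
      ext ξ
      change ξ _ = ξ _ + ξ _
      rw [← map_add]
      congr 1
      ext q
      change a * b * Q q - Q (quotMul L hL (a * b) q) =
        a * (b * Q q - Q (quotMul L hL b q)) +
          (a * Q (quotMul L hL b q) - Q (quotMul L hL a (quotMul L hL b q)))
      rw [quotMul_mul, mul_sub, mul_assoc]
      abel)
  -- Testing `Θ` on `T ↦ g (T e)` brings it down from the bidual to an operator `R` into `L` with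
  -- the same commutator as `Q`; so `Q - R` is a section commuting with `A`.
  let ω : (A ⧸ L) →L[ℂ] StrongDual ℂ A →L[ℂ] StrongDual ℂ ((A ⧸ L) →L[ℂ] L) :=
    LinearMap.mkContinuous₂
      (LinearMap.mk₂ ℂ (fun e g => (g.comp L.subtypeL).comp (ContinuousLinearMap.apply ℂ L e))
        (fun e e' g => by ext T; simp) (fun c e g => by ext T; simp)
        (fun e g g' => by ext T; simp) (fun c e g => by ext T; simp)) 1
      (fun e g => by
        refine ContinuousLinearMap.opNorm_le_bound _ (by positivity) fun T => ?_
        calc ‖g (T e)‖ ≤ ‖g‖ * (‖T‖ * ‖e‖) :=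
              (g.le_opNorm _).trans (by gcongr; exact T.le_opNorm e)
          _ = 1 * ‖e‖ * ‖g‖ * ‖T‖ := by ring)
  have hω : ∀ e g T, ω e g T = g (T e) := fun e g T => rfl
  obtain ⟨R, hR⟩ := hrefl.exists_operator ((ContinuousLinearMap.compL ℂ (StrongDual ℂ A) _ ℂ Θ).comp ω)
  replace hR : ∀ e g, g (R e) = Θ (ω e g) := hR
  have hRL : ∀ e, R e ∈ L := by
    intro e
    by_contra hcon
    obtain ⟨f, hf, hfe, -⟩ := exists_eq_zero_of_notMem (G := L) ‹_› hcon
    apply hfe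
    have : ω e f = 0 := by
      ext T
      exact hf _ (T e).2
    rw [hR, this, map_zero]
  refine ⟨Q - R, fun e => ?_, fun a e => ?_⟩
  · have : L.mkQL (R e) = 0 := (Submodule.Quotient.mk_eq_zero L).2 (hRL e)
    rw [sub_apply, map_sub, hQ, this, sub_zero]
  · have key : a * Q e - Q (quotMul L hL a e) = a * R e - R (quotMul L hL a e) := by
      refine eq_of_forall_dual_eq fun g => ?_
      have h := congrArg (fun Φ : StrongDual ℂ (StrongDual ℂ ((A ⧸ L) →L[ℂ] L)) => Φ (ω e g)) (hΘ a)
      change g (a * Q e - Q (quotMul L hL a e)) =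
        Θ (ω e (g.comp (ContinuousLinearMap.mul ℂ A a))) - Θ (ω (quotMul L hL a e) g) at h
      rw [h, ← hR, ← hR, map_sub]
      rfl
    simp only [sub_apply, mul_sub]
    rw [sub_eq_sub_iff_add_eq_add] at key ⊢
    rw [add_comm, ← key, add_comm]

end Section

end Amenable

/-! ### Semisimplicity from annihilators of maximal left ideals. -/

section Ring

variable {A : Type*} [Ring A]

/-- A ring in which the right annihilator of each maximal left ideal complements it is
semisimple. -/
theorem isSemisimpleRing_of_forall_maximal
    (h : ∀ I : Ideal A, I.IsMaximal → ∃ p : A, (∀ l ∈ I, l * p = 0) ∧ p - 1 ∈ I) :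
    IsSemisimpleRing A := by
  -- A proper socle would lie in a maximal `I`; but it contains `A p ≅ A ⧸ I`, which is simple, and
  -- `p ∉ I`.
  refine IsSemisimpleModule.of_sSup_simples_eq_top ?_
  by_contra hS
  obtain ⟨I, hI, hle⟩ := Ideal.exists_le_maximal _ hS
  obtain ⟨p, hIp, hp1⟩ := h I hI
  have hpI : p ∉ I := fun hp => hI.ne_top ((Ideal.eq_top_iff_one I).2 (by
    simpa using I.sub_mem hp hp1))
  let φ : A →ₗ[A] A := LinearMap.toSpanSingleton A A p
  have hker : LinearMap.ker φ = I := by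
    refine (hI.eq_of_le (fun htop => hpI ?_) fun l hl => hIp l hl).symm
    have h1 : (1 : A) ∈ LinearMap.ker φ := by rw [htop]; trivial
    have h2 : (1 : A) * p = 0 := h1
    rw [one_mul] at h2
    rw [h2]
    exact I.zero_mem
  have hsimple : IsSimpleModule A (LinearMap.range φ) := by
    have : IsSimpleModule A (A ⧸ LinearMap.ker φ) := by
      rw [hker]
      exact isSimpleModule_iff_isCoatom.2 hI.out
    exact IsSimpleModule.congr φ.quotKerEquivRange.symm
  exact hpI (hle ((le_sSup hsimple : LinearMap.range φ ≤ _) ⟨1, one_mul p⟩))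

end Ring

/-! ### Endomorphisms of simple modules and Wedderburn–Artin. -/

section NormedRing

variable {A : Type*} [NormedRing A] [NormedAlgebra ℂ A]

/-- An endomorphism of a cyclic module is determined by the image of the generator: it is right
multiplication by some `b`, hence bounded by `‖b‖`. -/
theorem exists_continuous_eq_end (I : Ideal A) [IsClosed (I : Set A)] (f : Module.End A (A ⧸ I)) :
    ∃ F : (A ⧸ I) →L[ℂ] (A ⧸ I), ∀ q, F q = f q := by
  obtain ⟨b, hb⟩ := I.mkQ_surjective (f (I.mkQ 1))
  have hf : ∀ x : A, f (Submodule.Quotient.mk x) = Submodule.Quotient.mk (x * b) := by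
    intro x
    have h1 : (Submodule.Quotient.mk x : A ⧸ I) = x • I.mkQ 1 := by
      rw [← map_smul, smul_eq_mul, mul_one]; rfl
    rw [h1, map_smul, ← hb, ← map_smul]
    rfl
  refine ⟨LinearMap.mkContinuous (f.restrictScalars ℂ) ‖b‖ fun q => ?_, fun q => rfl⟩
  refine le_of_forall_pos_lt_add fun ε hε => ?_
  obtain ⟨m, rfl, hm⟩ := Submodule.Quotient.norm_mk_lt (S := I) q
    (div_pos hε (by positivity : 0 < ‖b‖ + 1))
  rw [LinearMap.restrictScalars_apply, hf]
  calc ‖(Submodule.Quotient.mk (m * b) : A ⧸ I)‖ ≤ ‖m * b‖ := Submodule.Quotient.norm_mk_le I _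
    _ ≤ ‖m‖ * ‖b‖ := norm_mul_le _ _
    _ ≤ (‖(Submodule.Quotient.mk m : A ⧸ I)‖ + ε / (‖b‖ + 1)) * ‖b‖ := by gcongr
    _ = ‖b‖ * ‖(Submodule.Quotient.mk m : A ⧸ I)‖ + ε * (‖b‖ / (‖b‖ + 1)) := by ring
    _ < ‖b‖ * ‖(Submodule.Quotient.mk m : A ⧸ I)‖ + ε := by
      have : ‖b‖ / (‖b‖ + 1) < 1 := by rw [div_lt_one (by positivity)]; linarith
      nlinarith

variable [CompleteSpace A]

/-- The endomorphisms of the quotient by a maximal left ideal of a Banach algebra are scalar. -/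
theorem exists_eq_smul_of_end (I : Ideal A) (hI : I.IsMaximal) (f : Module.End A (A ⧸ I)) :
    ∃ c : ℂ, ∀ q, f q = c • q := by
  have : IsClosed (I : Set A) := Ideal.IsMaximal.isClosed
  have : IsSimpleModule A (A ⧸ I) := isSimpleModule_iff_isCoatom.2 hI.out
  have : Nontrivial (A ⧸ I) := IsSimpleModule.nontrivial A _
  obtain ⟨F, hF⟩ := exists_continuous_eq_end I f
  obtain ⟨c, hc⟩ := spectrum.nonempty F
  refine ⟨c, ?_⟩
  let g : Module.End A (A ⧸ I) := algebraMap ℂ _ c - f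
  have hg : ∀ q, g q = c • q - f q := fun q => rfl
  -- By Schur, `c - f` is zero or bijective. In the latter case its inverse is also `A`-linear,
  -- hence bounded, against `c` being in the spectrum.
  rcases LinearMap.bijective_or_eq_zero g with hbij | h0
  · exfalso
    let e := LinearEquiv.ofBijective g hbij
    obtain ⟨G, hG⟩ := exists_continuous_eq_end I (e.symm : Module.End A (A ⧸ I))
    have hFg : ∀ q, (algebraMap ℂ ((A ⧸ I) →L[ℂ] (A ⧸ I)) c - F) q = g q := fun q => by
      rw [hg, ← hF]; rfl
    refine (spectrum.mem_iff.1 hc) ⟨⟨algebraMap ℂ _ c - F, G, ?_, ?_⟩, rfl⟩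
    · ext q
      rw [mul_apply_eq_comp, hFg, hG]
      exact e.apply_symm_apply q
    · ext q
      rw [mul_apply_eq_comp, hFg, hG]
      exact e.symm_apply_apply q
  · intro q
    have := hg q
    rw [h0, LinearMap.zero_apply] at this
    exact (sub_eq_zero.1 this.symm).symm

theorem exists_algEquiv_pi_matrix [IsSemisimpleRing A] :
    ∃ (k : ℕ) (n : Fin k → ℕ), (∀ i, 0 < n i) ∧
      Nonempty (A ≃ₐ[ℂ] ∀ i : Fin k, Matrix (Fin (n i)) (Fin (n i)) ℂ) := by
  obtain ⟨k, S, d, hS, hd, ⟨e⟩⟩ := IsSemisimpleRing.exists_algEquiv_pi_matrix_end_mulOpposite ℂ A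
  refine ⟨k, d, fun i => Nat.pos_of_ne_zero (hd i).out, ⟨e.trans (AlgEquiv.piCongrRight fun i => ?_)⟩⟩
  have hbij : Function.Bijective (Algebra.ofId ℂ (Module.End A (S i))ᵐᵒᵖ) := by
    have := IsSimpleModule.nontrivial A (S i)
    refine ⟨(algebraMap ℂ (Module.End A (S i))ᵐᵒᵖ).injective, fun f => ?_⟩
    obtain ⟨I, hI, ⟨φ⟩⟩ := isSimpleModule_iff_quot_maximal.1 (hS i)
    obtain ⟨c, hc⟩ := exists_eq_smul_of_end I hI
      (φ.toLinearMap ∘ₗ f.unop ∘ₗ φ.symm.toLinearMap)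
    refine ⟨c, MulOpposite.unop_injective ?_⟩
    refine LinearMap.ext fun x => φ.injective ?_
    have h1 : φ (f.unop x) = c • φ x := by simpa using hc (φ x)
    rw [h1]
    change φ (c • x) = _
    rw [← algebraMap_smul A c x, map_smul, algebraMap_smul]
  exact (AlgEquiv.ofBijective _ hbij).symm.mapMatrix

/-- A unital Banach algebra in which the right annihilator of each closed maximal left ideal
complements it is a finite direct sum of full matrix algebras. -/
theorem isTrivial_of_forall_maximal
    (h : ∀ L : Submodule ℂ A, IsClosed (L : Set A) → IsMaximalLeftIdeal L →
      ∃ p : A, (∀ l ∈ L, l * p = 0) ∧ p - 1 ∈ L) : IsTrivial A := by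
  have : IsSemisimpleRing A := by
    refine isSemisimpleRing_of_forall_maximal fun I hI => ?_
    let L : Submodule ℂ A := I.restrictScalars ℂ
    have hLc : IsClosed (L : Set A) := Ideal.IsMaximal.isClosed (I := I)
    have hL : IsLeftIdeal L := fun a x hx => I.mul_mem_left a hx
    have hLmax : IsMaximalLeftIdeal L := by
      refine ⟨⟨hL, fun h => hI.ne_top ?_⟩, fun J ⟨hJ, hJtop⟩ hLJ => ?_⟩
      · exact (Submodule.restrictScalars_eq_top_iff ℂ A A).1 h
      · let J' : Ideal A := { J with smul_mem' := fun a x hx => hJ a x hx }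
        have hJ' : J' ≠ ⊤ := fun h => hJtop (eq_top_iff.2 fun x _ => by
          change x ∈ J'
          rw [h]; trivial)
        have hIJ : I = J' := hI.eq_of_le hJ' hLJ
        intro x hx
        change x ∈ I
        rw [hIJ]
        exact hx
    exact h L hLc hLmax
  obtain ⟨k, n, hn, ⟨e⟩⟩ := exists_algEquiv_pi_matrix (A := A)
  exact ⟨k, n, hn,
    { toFun := e
      map_smul' := map_smul e
      map_zero' := map_zero e
      map_add' := map_add e
      map_mul' := map_mul e }, e.bijective⟩

end NormedRing

end AmenableBanach

end

theorem theorem2p2 {A : Type*} [NonUnitalNormedRing A] [NormedSpace ℂ A]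
    [IsScalarTower ℂ A A] [SMulCommClass ℂ A A] [CompleteSpace A]
    (hrefl : AmenableBanach.IsReflexive A)
    (hamen : AmenableBanach.IsAmenable A)
    (hAP : ∀ (L : Submodule ℂ A) [IsClosed (L : Set A)], AmenableBanach.IsMaximalLeftIdeal L →
      AmenableBanach.HasApproximationProperty (A ⧸ L))
    (hopen : ∀ (L : Submodule ℂ A) [IsClosed (L : Set A)], AmenableBanach.IsMaximalLeftIdeal L →
      IsOpenMap (AmenableBanach.InjectiveTensor.map L.mkQL
        (ContinuousLinearMap.id ℂ (StrongDual.polarSubmodule ℂ L)))) :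
    AmenableBanach.IsTrivial A := by
  obtain ⟨e, he1, he2⟩ := hamen.exists_unit hrefl
  have hp : ∀ L : Submodule ℂ A, IsClosed (L : Set A) → AmenableBanach.IsMaximalLeftIdeal L →
      ∃ p : A, (∀ l ∈ L, l * p = 0) ∧ p - e ∈ L := by
    intro L hLc hLmax
    have hL := hLmax.prop.1
    obtain ⟨Q, hQ⟩ := hrefl.exists_rightInverse_mkQL L (hAP L hLmax) (hopen L hLmax)
    obtain ⟨ρ, hρ, hρmul⟩ := hamen.exists_module_section L hrefl hL Q hQ
    refine ⟨ρ (L.mkQL e), fun l hl => ?_, ?_⟩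
    · have : L.mkQL l = 0 := (Submodule.Quotient.mk_eq_zero L).2 hl
      rw [← hρmul, AmenableBanach.quotMul_mkQL, he2, this, map_zero]
    · rw [← Submodule.Quotient.mk_eq_zero]
      change L.mkQL _ = 0
      rw [map_sub, hρ, sub_self]
  -- The norm of `e` need not be 1, and `NormedRing` does not ask for it; the zero algebra is
  -- covered as well.
  let _ : NormedRing A :=
    { ‹NonUnitalNormedRing A› with
      one := e
      one_mul := he1
      mul_one := he2 }
  let _ : NormedAlgebra ℂ A :=
    { Algebra.ofModule (R := ℂ) (A := A) (fun r x y => smul_mul_assoc r x y)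
        (fun r x y => mul_smul_comm r x y) with
      norm_smul_le := fun r x => norm_smul_le r x }
  exact AmenableBanach.isTrivial_of_forall_maximal hp
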